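/- **Setting.** Let $L\subset S^3$ be a link with a connected prime alternating diagram $D$ having more than one crossing, and let $M$ be its exterior. View $D$ as a 4-valent graph $G(D)\subset S^2$ with crossing information; *prime* means that each simple closed curve in $S^2$ meeting $G(D)$ transversely in two interior points of edges bounds a disc containing no crossing. A region is a *bigon region* if it has precisely two edges in its boundary, and an edge is a *bigon edge* if it lies in the boundary of a bigon region. For a component $K$ of $L$, let $t(K,D)$ be half the number of non-bigon edges of $G(D)$ lying in $K$. *The spine.* $M$ has a handle structure $\mathcal H$ with two 0-handles, one on each side of $S^2$, a 1-handle for each region of $D$, joining the two 0-handles, and a 2-handle for each crossing. In the boundary sphere of each 0-handle, $\mathcal F=\mathcal H^0\cap(\mathcal H^1\cup\mathcal H^2)$ is a thickening of the graph dual to $G(D)$: its 0-handles $\mathcal F^0=\mathcal H^0\cap\mathcal H^1$ are the regions, its 1-handles $\mathcal F^1=\mathcal H^0\cap\mathcal H^2$ are the edges, and the components of $\partial\mathcal H^0-\mathcal F$ (which lie in $\partial M$) are the crossings. The 1-handle of a region $R$ identifies the copies of $R$ on the two spheres after a rotation through one edge of $R$, clockwise or anticlockwise according to the checkerboard colour of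 $R$. The *canonical angled spine* is this spine with exterior angle $\pi/2$ on every 1-handle of $\mathcal F$. *Admissible discs.* Let $H$ be a disc in a 0-handle of $\mathcal H$ whose boundary consists of arcs in $\mathcal F^0$ alternating with arcs running along 1-handles of $\mathcal F$, arcs in $\partial M$, and arcs through the interior of the 0-handle. It is *admissible* if no arc of $\partial H\cap\mathcal F^0$ has both its ends in the same component of $\partial\mathcal F^0\cap\mathcal F^1$, in the same component of $\partial\mathcal F^0-\mathcal F^1$, or in adjacent components of these two kinds, and no arc of $\partial H\cap\partial M$ has both ends in the same component of $\partial\mathcal F^0-\mathcal F^1$ (arcs are embedded, but $\partial H$ need not be, and it may run over a piece several times). If $\epsilon_1,\dots,\epsilon_r$ are the exterior angles of the 1-handles of $\mathcal F$ over which $\partial H$ runs, with multiplicity, its *combinatorial area* is $$a(H)=\sum_{j=1}^r\epsilon_j-2\pi+\pi\,|H\cap\partial M|+3\pi\,|\partial H-\partial\mathcal H^0|.$$ *Combinatorial length.* Let $C$ be a closed curve in $\partial M$, disjoint from the 2-handles and vertical in the 1-handles, composed cyclically of arcs $C^0_1,C^1_1,\dots,C^0_n,C^1_n$ with $C^j_i$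 in a $j$-handle. An *inward extension* $\mathcal E$ of $C$ consists of discs $H^j_i$ in $j$-handles of $\mathcal H$ with $C^j_i\subset \partial H^j_i$, the $H^0_i$ admissible, the $H^1_i$ respecting the product structures, such that the arcs of $\mathcal F^0\cap H^0_i$ and $\mathcal F^0\cap H^1_i$ touching $C^0_i\cap C^1_i$ agree and the arcs of $\mathcal F^0\cap H^1_i$ and $\mathcal F^0\cap H^0_{i+1}$ touching $C^1_i\cap C^0_{i+1}$ agree. Put $w(\mathcal E)=\sum_{i=1}^n a(H^0_i)/|H^0_i\cap\partial M|$, let $l(C)=\inf_{\mathcal E}w(\mathcal E)$ ($+\infty$ if $C$ has no inward extension), and let the combinatorial length $l(s)$ of a slope $s$ be the infimum of $l(C)$ over all $C$ that represent a non-zero multiple of $s$. **Theorem 5.4.** Give the exterior of $L$ the canonical angled spine arising from $D$. For each component $K$ of $L$ and all coprime integers $p,q$, the combinatorial length of the slope $p/q$ on $K$ (the class $p\mu+q\lambda$, with $\mu$ the meridian and $\lambda$ the preferred longitude of $K$) satisfies $$l(p/q)\;\ge\;|q|\;t(K,D)\;\frac{\pi}{4}.$$ -/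

import Mathlib

open Real

/-- A link diagram on the oriented 2-sphere with underlying 4-valent graph `G(D)`, encoded as a
combinatorial map. `X` is the set of half-edges. A half-edge `d` is based at a crossing and points
away from it.
* `rot d` is the next half-edge counterclockwise around the crossing at which `d` is based;
* `opp d` is the other half of the edge containing `d`, based at the other end of that edge;
* `isOver d` says whether the strand of the link containing `d` is the upper one at the crossing
  at which `d` is based.

Crossings, edges and regions are the cycles of `rot`, `opp` and `rot⁻¹ * opp`. The last field is
Euler's formula `V - E + F = 2 C` (`C` the number of connected pieces of the graph); it says that
the surface underlying each piece is a 2-sphere. -/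
structure LinkDiagram (X : Type*) [Fintype X] where
  rot : Equiv.Perm X
  opp : Equiv.Perm X
  isOver : X → Bool
  rot_four : ∀ d, rot (rot (rot (rot d))) = d
  rot_two_ne : ∀ d, rot (rot d) ≠ d
  opp_opp : ∀ d, opp (opp d) = d
  opp_ne : ∀ d, opp d ≠ d
  isOver_rot : ∀ d, isOver (rot d) = !isOver d
  planar :
    Nat.card (Quotient (Equiv.Perm.SameCycle.setoid rot)) +
        Nat.card (Quotient (Equiv.Perm.SameCycle.setoid (rot⁻¹ * opp))) =
      Nat.card (Quotient (Equiv.Perm.SameCycle.setoid opp)) +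
        2 * Nat.card (MulAction.orbitRel.Quotient
          (Subgroup.closure ({rot, opp} : Set (Equiv.Perm X))) X)

namespace LinkDiagram

variable {X : Type*} [Fintype X] (D : LinkDiagram X)

/-- Boundary walk of regions: `D.face d` is the half-edge that follows `d` on the boundary of the
region lying to the left of `d`. The cycles of `D.face` are the regions of the diagram; the region
"of `d`" is the one to the left of `d`. -/
def face : Equiv.Perm X := D.rot⁻¹ * D.opp

/-- Walking along the link: follow the edge of `d` to its far end and go straight on through the
crossing there. The component of the link through `d`, oriented by `d`, is the cycle of `d`; it
contains each edge of that component once, namely its half-edge that points in the direction of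
travel. -/
def travel : Equiv.Perm X := D.rot * D.rot * D.opp

/-- The two half-edges are based at the same crossing. -/
def SameCrossing (c d : X) : Prop := D.rot.SameCycle c d

/-- The half-edges have the same region on their left. -/
def SameRegion (c d : X) : Prop := D.face.SameCycle c d

/-- `d` is an edge, pointing in the direction of travel, of the component through `k`,
oriented by `k`. -/
def OnComponent (k d : X) : Prop := D.travel.SameCycle k d

/-- The number of crossings. -/
noncomputable def crossingNumber : ℕ := Nat.card (Quotient (Equiv.Perm.SameCycle.setoid D.rot))

/-- The graph `G(D)` is connected (and not empty). -/
def IsConnected : Prop :=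
  Nat.card (MulAction.orbitRel.Quotient
    (Subgroup.closure ({D.rot, D.opp} : Set (Equiv.Perm X))) X) = 1

/-- Along each edge the link passes from an over-crossing to an under-crossing. -/
def IsAlternating : Prop := ∀ d, D.isOver (D.opp d) = !D.isOver d

/-- Primeness of a connected diagram. A simple closed curve that meets `G(D)` transversely in two
interior points of edges crosses an edge `d` from the region on its left to the region on its
right, and comes back through an edge `e` with the same two regions on its left and right. If the
two crossed edges are different, each of them has exactly one end on each side of the curve, so
both discs contain a crossing; if they agree, one of the discs meets `G(D)` only in an arc of that
edge. So primeness says that the two crossed edges always agree. -/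
def IsPrime : Prop :=
  ∀ d e, D.SameRegion d e → D.SameRegion (D.opp d) (D.opp e) → e = d

/-- The region to the left of `d` has precisely two edges in its boundary. -/
def IsBigonRegion (d : X) : Prop := D.face d ≠ d ∧ D.face (D.face d) = d

/-- The edge of `d` lies in the boundary of a bigon region. -/
def IsBigonEdge (d : X) : Prop := D.IsBigonRegion d ∨ D.IsBigonRegion (D.opp d)

open Classical in
/-- `t(K, D)`: half the number of non-bigon edges lying in the component `K` through `k`. -/
noncomputable def twistNumber (k : X) : ℝ :=
  ((Finset.univ.filter fun d => D.OnComponent k d ∧ ¬ D.IsBigonEdge d).card : ℝ) / 2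

/-! ### The spine of an alternating link exterior

The handle structure `H` obtained by thickening the spine has two 0-handles, the upper (`true`) and
the lower one (`false`), a 1-handle for each region of the diagram, joining the two 0-handles, and
a 2-handle for each crossing. In the boundary sphere of either 0-handle, the surface
`F = H⁰ ∩ (H¹ ∪ H²)` is a thickening of the graph dual to `G(D)`:
* its 0-handles are the regions, its 1-handles are the edges, and the components of `∂H⁰ - F`
  are the crossings;
* the boundary circle of the 0-handle of `F` in a region is cut into *sides*, where it meets the
  1-handles of `F`, and *corners*, where it meets `∂M`. The side `d` lies on the left of `d`, along
  its edge. The corner `d` lies at the crossing at which `d` is based, in the sector between `d`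
  and `D.rot d`. Both belong to the region on the left of `d`, and in the cyclic order around
  this region the corner `d` comes just before the side `d` and just after the side
  `D.face⁻¹ d`. -/

/-- The product structure of the 1-handle of a region identifies the 0-handle of `F` in the region
on the sphere of the 0-handle `s` with that on the sphere of the other 0-handle, by a rotation
through one step. From the upper to the lower 0-handle every corner and side moves on by one step
along the boundary of the region, in the direction in which the edges of the region run from
their over-crossing end to their under-crossing end (in an alternating diagram this direction is
the same for all edges of a region and it is opposite for adjacent regions). From the lower to the
upper 0-handle this is inverted. The label `d` of a corner or side on the sphere of `s` goes to
`D.glue s d`. -/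
def glue (s : Bool) (d : X) : X := if D.isOver d = s then D.face d else D.face⁻¹ d

/-! ### The boundary tori and slopes

The 0-handles of `∂M` are the components of `∂H⁰ - F`: at each crossing one for the upper 0-handle
(it lies on the over-strand) and one for the lower 0-handle (on the under-strand). The 1-handles
of `∂M`, here called strips, are the pieces of the 1-handles of `H` on `∂M`: the strip `c` joins the
corner `c` of the upper 0-handle with the corner `D.glue true c` of the lower one. A 1-chain is an
integral combination of strips, each oriented from the upper to the lower 0-handle. -/

/-- The boundary of a 2-handle of `∂M`. It runs along four strips, alternately down and up; in the
upper and lower 0-handles of `∂M` in between it goes from a corner to an adjacent one. It starts at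
the upper corner `c`. -/
noncomputable def twoHandleBoundary (c : X) : X →₀ ℤ :=
  let c₂ := D.glue false (D.rot⁻¹ (D.glue true c))
  let c₃ := D.rot c₂
  let c₄ := D.glue false (D.rot⁻¹ (D.glue true c₃))
  Finsupp.single c 1 - Finsupp.single c₂ 1 + Finsupp.single c₃ 1 - Finsupp.single c₄ 1

/-- Two 1-cycles in `∂M` are homologous. -/
def Homologous (z z' : X →₀ ℤ) : Prop :=
  z - z' ∈ AddSubgroup.closure (Set.range D.twoHandleBoundary)

/-- The strip on the left of the edge of `d`: the edge runs between the upper 0-handle of `∂M` at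
its over-crossing end and the lower one at its under-crossing end. -/
def leftStrip (d : X) : X := if D.isOver d then d else D.rot⁻¹ (D.opp d)

/-- The meridian of the link at the edge of `d`, oriented so that its linking number with the
component through `d`, oriented by `d`, is `+1`: it runs down on the right of the edge and
up on its left. -/
noncomputable def meridian (d : X) : X →₀ ℤ :=
  Finsupp.single (D.leftStrip (D.opp d)) 1 - Finsupp.single (D.leftStrip d) 1

open Classical in
/-- The parallel of the oriented component through `k` given by the blackboard framing: it runs
along the strips on the left of the component, down along the edges that are travelled from their
over-crossing end, up along the others. -/
noncomputable def blackboardLongitude (k : X) : X →₀ ℤ :=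
  ∑ d ∈ Finset.univ.filter (fun d => D.OnComponent k d),
    Finsupp.single (D.leftStrip d) (if D.isOver d then 1 else -1)

open Classical in
/-- The sum of the signs of the crossings of the component through `k` with itself, which is the
linking number of the component with its blackboard parallel. A crossing is positive if the
outgoing half-edge of its under-strand is the one just counterclockwise from the outgoing
half-edge `d` of its over-strand. -/
noncomputable def selfWrithe (k : X) : ℤ :=
  ∑ d ∈ Finset.univ.filter (fun d => D.OnComponent k d ∧ D.isOver d = true),
    ((if D.OnComponent k (D.rot d) then 1 else 0) -
      (if D.OnComponent k (D.rot⁻¹ d) then 1 else 0))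

/-- The preferred longitude of the component through `k`: it is parallel to the component and has
linking number zero with it. -/
noncomputable def longitude (k : X) : X →₀ ℤ :=
  D.blackboardLongitude k - D.selfWrithe k • D.meridian k

/-- The slope `p/q` on the boundary torus of the component through `k`. -/
noncomputable def slope (k : X) (p q : ℤ) : X →₀ ℤ :=
  p • D.meridian k + q • D.longitude k

/-- A closed curve `C` in `∂M`, disjoint from the 2-handles and vertical in the 1-handles, up to
isotopy respecting the handles. It consists of arcs `C⁰ᵢ` in 0-handles of `∂M` and arcs `C¹ᵢ`
in strips, with `C¹ᵢ` between `C⁰ᵢ` and `C⁰ᵢ₊₁`, the indices being read modulo `n`. The arc `C⁰ᵢ`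
lies in the 0-handle `sheet i` of `H`, and runs from the corner `first i` to the corner `last i`
of one crossing. -/
structure BoundaryCurve where
  n : ℕ
  n_pos : 0 < n
  sheet : ℕ → Bool
  first : ℕ → X
  last : ℕ → X
  sameCrossing : ∀ i, D.SameCrossing (first i) (last i)
  sheet_succ : ∀ i, sheet (i + 1) = !sheet i
  first_succ : ∀ i, first (i + 1) = D.glue (sheet i) (last i)
  sheet_periodic : ∀ i, sheet (i + n) = sheet i
  first_periodic : ∀ i, first (i + n) = first i
  last_periodic : ∀ i, last (i + n) = last i

/-- The 1-cycle of a curve in `∂M`. -/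
noncomputable def BoundaryCurve.cycle {D : LinkDiagram X} (C : D.BoundaryCurve) : X →₀ ℤ :=
  ∑ i ∈ Finset.range C.n,
    if C.sheet i then Finsupp.single (C.last i) 1 else -Finsupp.single (C.first (i + 1)) 1

/-- The curve represents a non-zero multiple of the slope `σ`. -/
def BoundaryCurve.Represents {D : LinkDiagram X} (C : D.BoundaryCurve) (σ : X →₀ ℤ) : Prop :=
  ∃ m : ℤ, m ≠ 0 ∧ D.Homologous C.cycle (m • σ)

/-! ### Angles, admissible discs and combinatorial area -/

/-- An exterior angle in the range `(0, π)` for each edge of `G(D)`, hence for each 1-handle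
of `F`. -/
structure ExteriorAngles where
  angle : X → ℝ
  angle_opp : ∀ d, angle (D.opp d) = angle d
  angle_pos : ∀ d, 0 < angle d
  angle_lt : ∀ d, angle d < π

/-- The angles of the canonical angled spine: all exterior angles are `π / 2`. -/
noncomputable def canonicalAngles : D.ExteriorAngles where
  angle _ := π / 2
  angle_opp _ := rfl
  angle_pos _ := by positivity
  angle_lt _ := by linarith [Real.pi_pos]

end LinkDiagram

/-- An end of an arc in a 0-handle of `F`: on the side `d`, on the corner `d`, or at an interior
point of the 0-handle of `F` in the region of `d`. -/
inductive ArcEnd (X : Type*)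
  | side (d : X)
  | corner (d : X)
  | interior (d : X)

/-- A piece of the boundary of a disc `H` in a 0-handle of `H⁰` between two consecutive arcs of
`∂H` in the 0-handles of `F`:
* `cross d`: it runs along the 1-handle of `F` dual to the edge of `d`, from the side `d` to the
  side `opp d`;
* `boundary c c'`: an arc in `∂M`, from the corner `c` to the corner `c'`;
* `free d d'`: an arc through the interior of the 0-handle of `H⁰` (a component of `∂H - ∂H⁰`),
  from the region of `d` to the region of `d'`. -/
inductive Jump (X : Type*)
  | cross (d : X)
  | boundary (c c' : X)
  | free (d d' : X)

namespace LinkDiagram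

variable {X : Type*} [Fintype X] (D : LinkDiagram X)

/-- Two ends in one region can be joined by an arc of an admissible curve: the ends do not lie on
the same side, nor on the same corner, nor on a side and a corner that are adjacent. There is no
condition on an arc with an end in the interior. -/
def AdmissibleArc : ArcEnd X → ArcEnd X → Prop
  | .side d, .side e => D.SameRegion d e ∧ d ≠ e
  | .corner c, .corner e => D.SameRegion c e ∧ c ≠ e
  | .side d, .corner c => D.SameRegion d c ∧ c ≠ d ∧ c ≠ D.face d
  | .corner c, .side d => D.SameRegion c d ∧ c ≠ d ∧ c ≠ D.face d
  | .interior r, .side d => D.SameRegion r d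
  | .interior r, .corner c => D.SameRegion r c
  | .interior r, .interior r' => D.SameRegion r r'
  | .side d, .interior r => D.SameRegion d r
  | .corner c, .interior r => D.SameRegion c r

/-- The product structure of a 1-handle of `H` takes an end of an arc on the sphere of the 0-handle
`s` to an end of an arc on the sphere of the other 0-handle. -/
def MatchEnds (s : Bool) : ArcEnd X → ArcEnd X → Prop
  | .side d, .side e => e = D.glue s d
  | .corner c, .corner e => e = D.glue s c
  | .interior r, .interior r' => D.SameRegion r r'
  | _, _ => False

end LinkDiagram

namespace Jump

variable {X : Type*} [Fintype X] (D : LinkDiagram X)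

/-- Where the piece starts. -/
def source : Jump X → ArcEnd X
  | cross d => .side d
  | boundary c _ => .corner c
  | free d _ => .interior d

/-- Where the piece stops. -/
def target : Jump X → ArcEnd X
  | cross d => .side (D.opp d)
  | boundary _ c' => .corner c'
  | free _ d' => .interior d'

/-- An arc in `∂M` joins two different corners of one crossing. -/
def Admissible : Jump X → Prop
  | cross _ => True
  | boundary c c' => D.SameCrossing c c' ∧ c ≠ c'
  | free _ _ => True

/-- The contribution of a piece to the combinatorial area. -/
noncomputable def area {D : LinkDiagram X} (θ : D.ExteriorAngles) : Jump X → ℝ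
  | cross d => θ.angle d
  | boundary _ _ => π
  | free _ _ => 3 * π

/-- `1` if the piece is an arc in `∂M`, else `0`. -/
def boundaryCount : Jump X → ℕ
  | cross _ => 0
  | boundary _ _ => 1
  | free _ _ => 0

end Jump

namespace LinkDiagram

variable {X : Type*} [Fintype X] (D : LinkDiagram X)

/-- The boundary of a disc `H` in a 0-handle of `H⁰` for which `∂H ∩ ∂H⁰` is admissible, up to
homotopy: a cyclic sequence of `m ≥ 1` pieces (see `Jump`), where the piece `j` is joined to the
piece `j + 1` by an arc in a 0-handle of `F`. The curve may run several times over the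
same 1-handle of `F` or the same component of `∂H⁰ - F`, and it may cross itself. -/
structure AdmissibleDisc where
  m : ℕ
  m_pos : 0 < m
  jump : ℕ → Jump X
  jump_admissible : ∀ j, (jump j).Admissible D
  arc_admissible : ∀ j, D.AdmissibleArc ((jump j).target D) (jump (j + 1)).source
  periodic : ∀ j, jump (j + m) = jump j

/-- The combinatorial area `a(H) = ∑ εᵢ - 2π + π |H ∩ ∂M| + 3π |∂H - ∂H⁰|`. -/
noncomputable def AdmissibleDisc.area {D : LinkDiagram X} (θ : D.ExteriorAngles)
    (H : D.AdmissibleDisc) : ℝ :=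
  ∑ j ∈ Finset.range H.m, (H.jump j).area θ - 2 * π

/-- `|H ∩ ∂M|`. -/
def AdmissibleDisc.boundaryCount {D : LinkDiagram X} (H : D.AdmissibleDisc) : ℕ :=
  ∑ j ∈ Finset.range H.m, (H.jump j).boundaryCount

/-- An inward extension of a curve `C`: an admissible disc `H⁰ᵢ` for each `i` (modulo `n`), whose
boundary contains `C⁰ᵢ` (here as piece number `0`), such that the arc of `∂H⁰ᵢ` in `F⁰` that follows
`C⁰ᵢ` and the arc of `∂H⁰ᵢ₊₁` in `F⁰` that precedes `C⁰ᵢ₊₁` are the two ends of a disc `H¹ᵢ` in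
a 1-handle of `H` that contains `C¹ᵢ` and respects the product structure. -/
structure InwardExtension (C : D.BoundaryCurve) where
  disc : ℕ → D.AdmissibleDisc
  periodic : ∀ i, disc (i + C.n) = disc i
  contains : ∀ i, (disc i).jump 0 = Jump.boundary (C.first i) (C.last i)
  agree : ∀ i, D.MatchEnds (C.sheet i) ((disc i).jump 1).source
    (((disc (i + 1)).jump ((disc (i + 1)).m - 1)).target D)

/-- The weight of an inward extension. -/
noncomputable def InwardExtension.weight {D : LinkDiagram X} {C : D.BoundaryCurve}
    (θ : D.ExteriorAngles) (E : D.InwardExtension C) : ℝ :=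
  ∑ i ∈ Finset.range C.n, (E.disc i).area θ / ((E.disc i).boundaryCount : ℝ)

/-- The combinatorial length of a curve: the infimum of the weights of its inward extensions, and
`⊤` if there are none. -/
noncomputable def BoundaryCurve.length {D : LinkDiagram X} (θ : D.ExteriorAngles)
    (C : D.BoundaryCurve) : EReal :=
  ⨅ E : D.InwardExtension C, (E.weight θ : EReal)

/-- The combinatorial length of a slope: the infimum of the lengths of the curves that represent
a non-zero multiple of it. -/
noncomputable def combinatorialLength {D : LinkDiagram X} (θ : D.ExteriorAngles)
    (σ : X →₀ ℤ) : EReal :=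
  ⨅ C : {C : D.BoundaryCurve // C.Represents σ}, C.1.length θ

end LinkDiagram

/-!
Combinatorial length of slopes on an alternating link exterior.

For the canonical angles the area of a disc is `π / 2` times an integer, and a disc `H⁰ᵢ` of an inward
extension contributes at least `π / 4` to the weight unless it is one of a few *light* discs
(`IsPrime.area_or_isLight`), which contribute at least `0`. The boundary of a light disc passes
through two opposite corners of a crossing and crosses two edges, or passes through opposite corners
of two crossings, or surrounds a single edge. Parity is read off from the checkerboard colouring,
which in an alternating diagram is `isOver`: it is constant on regions.

Suppose that two consecutive discs are light, and join them along the strip `C¹ᵢ`. The gluing rotates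
by one step around the region `R` containing this strip. If the two discs pass through opposite
corners, then the first curve leaves `R` at two places, and the second one at the two places that
follow them, so the two curves cross once in `R`. By the Jordan curve theorem they meet in another
region. The colouring and primeness leave only the region opposite to both corners, and primeness
then shows that the edge along which `C¹ᵢ` runs bounds a bigon. The form of the Jordan curve theorem
needed here is the vanishing of the first cohomology of the sphere modulo 2
(`IsConnected.exists_cut`), which is a rank computation from Euler's formula.

A disc that surrounds an edge needs more care, because it may be light without any bigon: the curve
can turn around an edge (`IsTurn`), as the boundary of a 2-handle does. But at a turn the curve
runs along the same edge in both directions, so that turns cancel in the algebraic count of how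
often `C` runs along an edge (`InwardExtension.abs_sum_stepCount_le`). This count is a homology
invariant and equals `± m q` for each edge of the component if `C` represents `m` times the slope
`p / q` (`BoundaryCurve.abs_sum_stepCount`). So for each non-bigon edge of the component at least
`|q|` strips remain, each of them has a disc of weight at least `π / 4` at one of its ends, and each
disc has at most two such strips. The number of non-bigon edges being `2 t`, the weight is
at least `|q| t π / 4`.
-/

namespace LinkDiagram

variable {X : Type*} [Fintype X] {D : LinkDiagram X}

/-! ### Half-edges, corners and regions -/

@[simp] lemma rot_inv_rot (d : X) : D.rot⁻¹ (D.rot d) = d := by simp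

@[simp] lemma rot_rot_inv (d : X) : D.rot (D.rot⁻¹ d) = d := by simp

lemma face_apply (d : X) : D.face d = D.rot⁻¹ (D.opp d) := rfl

lemma rot_face (d : X) : D.rot (D.face d) = D.opp d := by simp [face_apply]

lemma face_opp (d : X) : D.face (D.opp d) = D.rot⁻¹ d := by simp [face_apply, D.opp_opp]

lemma face_opp_rot (d : X) : D.face (D.opp (D.rot d)) = d := by simp [face_opp]

lemma face_inv_apply (d : X) : D.face⁻¹ d = D.opp (D.rot d) := by
  rw [Equiv.Perm.inv_eq_iff_eq, face_opp_rot]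

lemma face_face_inv (d : X) : D.face (D.face⁻¹ d) = d := by simp

lemma face_inv_face (d : X) : D.face⁻¹ (D.face d) = d := by simp

lemma rot_inv_rot_inv (d : X) : D.rot⁻¹ (D.rot⁻¹ d) = D.rot (D.rot d) := by
  rw [Equiv.Perm.inv_eq_iff_eq, Equiv.Perm.inv_eq_iff_eq, D.rot_four]

lemma rot_inv_eq (d : X) : D.rot⁻¹ d = D.rot (D.rot (D.rot d)) := by
  rw [Equiv.Perm.inv_eq_iff_eq, D.rot_four]

lemma sameRegion_face (d : X) : D.SameRegion d (D.face d) :=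
  Equiv.Perm.sameCycle_apply_right.2 (Equiv.Perm.SameCycle.refl _ _)

/-- The region to the right of `d` contains the corner just clockwise from `d`. -/
lemma sameRegion_opp (d : X) : D.SameRegion (D.opp d) (D.rot⁻¹ d) := by
  simpa [face_opp] using sameRegion_face (D := D) (D.opp d)

lemma sameRegion_opp_rot (d : X) : D.SameRegion (D.opp (D.rot d)) d := by
  simpa using sameRegion_opp (D := D) (D.rot d)

/-- A function that is constant along the boundary walk of a region takes one value there. -/
lemma SameRegion.eq_of_face {α : Type*} (g : X → α) {c x : X} (hx : D.SameRegion c x)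
    (hg : ∀ d, D.SameRegion c d → g (D.face d) = g d) : g x = g c := by
  obtain ⟨i, -, -, rfl⟩ := Equiv.Perm.SameCycle.exists_pow_eq'' hx
  clear hx
  induction i with
  | zero => rfl
  | succ i ih =>
    rw [pow_succ', Equiv.Perm.mul_apply, hg _ ⟨i, by simp⟩, ih]

lemma sameCrossing_cases {c c' : X} (h : D.SameCrossing c c') :
    c' = c ∨ c' = D.rot c ∨ c' = D.rot (D.rot c) ∨ c' = D.rot⁻¹ c := by
  obtain ⟨i, -, -, rfl⟩ := Equiv.Perm.SameCycle.exists_pow_eq'' h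
  clear h
  induction i with
  | zero => simp
  | succ i ih =>
    rw [pow_succ', Equiv.Perm.mul_apply]
    rcases ih with h | h | h | h <;> rw [h] <;> simp [rot_inv_eq, D.rot_four]

/-- In a connected diagram, a quantity that does not change around crossings and along edges is
constant. -/
lemma IsConnected.eq_of_invariant (hD : D.IsConnected) {α : Type*} (g : X → α)
    (hrot : ∀ d, g (D.rot d) = g d) (hopp : ∀ d, g (D.opp d) = g d) (c d : X) : g c = g d := by
  have hs := (Nat.card_eq_one_iff_unique.1 hD).1
  have h := Quotient.exact (hs.elim (Quotient.mk _ c) (Quotient.mk _ d))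
  obtain ⟨⟨σ, hσ⟩, h⟩ := h
  have key : ∀ x, g (σ x) = g x := by
    clear h
    induction hσ using Subgroup.closure_induction with
    | mem τ hτ =>
      rcases hτ with rfl | rfl
      · exact hrot
      · exact hopp
    | one => simp
    | mul σ τ _ _ h1 h2 => intro x; rw [Equiv.Perm.mul_apply, h1, h2]
    | inv σ _ h => intro x; rw [← h (σ⁻¹ x)]; simp
  rw [← key d]
  exact congrArg g h.symm

/-! ### The checkerboard colouring -/

lemma isOver_rot_inv (d : X) : D.isOver (D.rot⁻¹ d) = !D.isOver d := by
  have := D.isOver_rot (D.rot⁻¹ d)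
  simp only [rot_rot_inv] at this
  simp [this]

lemma IsAlternating.isOver_face (h : D.IsAlternating) (d : X) :
    D.isOver (D.face d) = D.isOver d := by
  rw [face_apply, isOver_rot_inv, h, Bool.not_not]

/-- In an alternating diagram `isOver` is a checkerboard colouring: it is constant on regions. -/
lemma SameRegion.isOver_eq {c d : X} (hcd : D.SameRegion c d) (h : D.IsAlternating) :
    D.isOver d = D.isOver c :=
  hcd.eq_of_face D.isOver fun e _ => h.isOver_face e

lemma isOver_rot_rot (d : X) : D.isOver (D.rot (D.rot d)) = D.isOver d := by
  simp [D.isOver_rot]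

/-! ### Reduced diagrams -/

/-- No region meets a crossing in two opposite corners. Otherwise primeness would close up the
four half-edges at this crossing, and there would be no further crossing. -/
lemma IsPrime.not_sameRegion_rot_rot (hprime : D.IsPrime) (hconn : D.IsConnected)
    (hcr : 1 < D.crossingNumber) (c : X) : ¬ D.SameRegion c (D.rot (D.rot c)) := by
  intro h
  have key : ∀ x, D.SameRegion x (D.rot (D.rot x)) →
      D.opp (D.rot (D.rot x)) = D.rot x := by
    intro x hx
    apply hprime
    · exact (sameRegion_opp_rot _).symm
    · rw [D.opp_opp]
      exact (sameRegion_opp_rot x).trans hx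
  have h1 := key c h
  have h2 : D.opp c = D.rot (D.rot (D.rot c)) := by
    have := key (D.rot (D.rot c)) (by rw [D.rot_four]; exact h.symm)
    rwa [D.rot_four] at this
  have h1' : D.opp (D.rot c) = D.rot (D.rot c) := by
    simpa [h1] using D.opp_opp (D.rot (D.rot c))
  have h2' : D.opp (D.rot (D.rot (D.rot c))) = c := by rw [← h2, D.opp_opp]
  have hcard : D.crossingNumber ≤ 1 := by
    have hall : ∀ x, D.SameCrossing c x := by
      intro x
      have hinv := hconn.eq_of_invariant (fun x => D.SameCrossing c x)
        (fun d => propext Equiv.Perm.sameCycle_apply_right) (fun d => by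
          have aux : ∀ d, D.SameCrossing c d → D.SameCrossing c (D.opp d) := by
            intro d hd
            have hr : ∀ e, D.SameCrossing c e → D.SameCrossing c (D.rot e) :=
              fun e he => Equiv.Perm.sameCycle_apply_right.2 he
            have h0 : D.SameCrossing c c := Equiv.Perm.SameCycle.refl _ _
            rcases sameCrossing_cases hd with e | e | e | e <;> rw [e]
            · rw [h2]; exact hr _ (hr _ (hr _ h0))
            · rw [h1']; exact hr _ (hr _ h0)
            · rw [h1]; exact hr _ h0
            · rw [rot_inv_eq, h2']; exact h0
          exact propext ⟨fun hd => by simpa [D.opp_opp] using aux _ hd, aux d⟩) x c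
      exact hinv.mpr (Equiv.Perm.SameCycle.refl _ _)
    have : Subsingleton (Quotient (Equiv.Perm.SameCycle.setoid D.rot)) := by
      refine ⟨fun a b => ?_⟩
      induction a using Quotient.inductionOn
      induction b using Quotient.inductionOn
      exact Quotient.sound ((hall _).symm.trans (hall _))
    exact Finite.card_le_one_iff_subsingleton.2 inferInstance
  omega

/-- No region is bounded by a single edge. -/
lemma IsPrime.face_ne (hprime : D.IsPrime) (hconn : D.IsConnected)
    (hcr : 1 < D.crossingNumber) (d : X) : D.face d ≠ d := by
  intro h
  have h1 : D.opp d = D.rot d := by rw [← rot_face, h]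
  apply hprime.not_sameRegion_rot_rot hconn hcr (D.rot d)
  rw [← rot_inv_eq, ← h1]
  exact sameRegion_opp d

/-- If the regions opposite to a given region at two consecutive crossings on its boundary agree,
then the edge between these two crossings bounds a bigon on its other side. -/
lemma IsPrime.isBigonRegion_opp (hprime : D.IsPrime) (hconn : D.IsConnected)
    (hcr : 1 < D.crossingNumber) {c : X}
    (h : D.SameRegion (D.rot (D.rot c)) (D.rot (D.rot (D.face c)))) :
    D.IsBigonRegion (D.opp c) := by
  -- The edges that follow `c` at its two ends, turning away from the given region, separate the
  -- same two regions.
  have key : D.opp (D.rot (D.opp c)) = D.rot⁻¹ c := by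
    apply hprime
    · exact (sameRegion_opp c).symm.trans (sameRegion_opp_rot _).symm
    · rw [D.opp_opp]
      rw [rot_face] at h
      refine Equiv.Perm.SameCycle.trans (sameRegion_opp _) ?_
      rw [rot_inv_rot_inv]
      exact h
  refine ⟨hprime.face_ne hconn hcr _, ?_⟩
  rw [face_opp, ← key, face_opp_rot]

/-! ### Separation by closed curves

Euler's formula says that the first cohomology of the sphere vanishes: a set of edges that meets the
boundary of each region an even number of times is the set of edges between two classes of
crossings. -/

open Classical in
/-- The incidence matrix, modulo 2, of the cycles of two permutations of the half-edges. -/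
noncomputable def incidence (σ τ : Equiv.Perm X) :
    Matrix (Quotient (Equiv.Perm.SameCycle.setoid σ)) (Quotient (Equiv.Perm.SameCycle.setoid τ))
      (ZMod 2) :=
  fun a b => ∑ d : X, if Quotient.mk _ d = a ∧ Quotient.mk _ d = b then 1 else 0

open Classical in
lemma incidence_transpose (σ τ : Equiv.Perm X) :
    (incidence σ τ).transpose = incidence τ σ := by
  ext a b
  exact Finset.sum_congr rfl fun d _ => if_congr and_comm rfl rfl

open Classical in
noncomputable instance (σ : Equiv.Perm X) :
    Fintype (Quotient (Equiv.Perm.SameCycle.setoid σ)) := Fintype.ofFinite _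

open Classical in
lemma incidence_mulVec (σ τ : Equiv.Perm X)
    (g : Quotient (Equiv.Perm.SameCycle.setoid τ) → ZMod 2)
    (a : Quotient (Equiv.Perm.SameCycle.setoid σ)) :
    (incidence σ τ).mulVec g a =
      ∑ d : X, if Quotient.mk _ d = a then g (Quotient.mk _ d) else 0 := by
  simp only [Matrix.mulVec, dotProduct, incidence, Finset.sum_mul]
  rw [Finset.sum_comm]
  refine Finset.sum_congr rfl fun d _ => ?_
  rw [Finset.sum_eq_single (Quotient.mk _ d)]
  · simp
  · intro b _ hb
    rw [if_neg (fun h => hb h.2.symm), zero_mul]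
  · simp

open Classical in
lemma incidence_opp_mulVec (τ : Equiv.Perm X)
    (g : Quotient (Equiv.Perm.SameCycle.setoid τ) → ZMod 2) (d : X) :
    (incidence D.opp τ).mulVec g (Quotient.mk _ d) =
      g (Quotient.mk _ d) + g (Quotient.mk _ (D.opp d)) := by
  rw [incidence_mulVec, ← Finset.sum_filter]
  have : (Finset.univ.filter fun e : X =>
      (Quotient.mk (Equiv.Perm.SameCycle.setoid D.opp) e) = Quotient.mk _ d) =
      {d, D.opp d} := by
    ext e
    simp only [Finset.mem_filter, Finset.mem_univ, true_and, Finset.mem_insert,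
      Finset.mem_singleton]
    constructor
    · intro h
      obtain ⟨i, -, -, rfl⟩ :=
        Equiv.Perm.SameCycle.exists_pow_eq'' (Equiv.Perm.SameCycle.symm (Quotient.exact h))
      clear h
      induction i with
      | zero => simp
      | succ i ih =>
        rw [pow_succ', Equiv.Perm.mul_apply]
        rcases ih with h | h <;> rw [h] <;> simp [D.opp_opp]
    · rintro (rfl | rfl)
      · rfl
      · exact Quotient.sound (Equiv.Perm.sameCycle_apply_left.2 (Equiv.Perm.SameCycle.refl _ _))
  rw [this, Finset.sum_pair (D.opp_ne d).symm]

/-- The kernel of the coboundary from crossings (`τ = D.rot`) or from regions (`τ = D.face`) to edges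
consists of the constant functions only, because the diagram is connected. -/
lemma IsConnected.card_le_rank_incidence (hconn : D.IsConnected) (τ : Equiv.Perm X)
    (hτ : ∀ (α : Type) (g : X → α), (∀ d, g (τ d) = g d) → (∀ d, g (D.opp d) = g d) →
      ∀ d, g (D.rot d) = g d) :
    Nat.card (Quotient (Equiv.Perm.SameCycle.setoid τ)) ≤ (incidence D.opp τ).rank + 1 := by
  have h1 : Module.finrank (ZMod 2) (LinearMap.ker (incidence D.opp τ).mulVecLin) ≤ 1 := by
    refine finrank_le_one (⟨fun _ => 1, ?_⟩ : LinearMap.ker (incidence D.opp τ).mulVecLin) ?_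
    · rw [LinearMap.mem_ker]
      ext e
      induction e using Quotient.inductionOn
      rw [Matrix.mulVecLin_apply, incidence_opp_mulVec]
      rfl
    · rintro ⟨g, hg⟩
      rw [LinearMap.mem_ker] at hg
      have hopp : ∀ d, g (Quotient.mk _ (D.opp d)) = g (Quotient.mk _ d) := by
        intro d
        have := congrFun hg (Quotient.mk _ d)
        rw [Matrix.mulVecLin_apply, incidence_opp_mulVec, Pi.zero_apply] at this
        exact (CharTwo.add_eq_zero.1 this).symm
      have hτ' : ∀ d, g (Quotient.mk _ (τ d)) = g (Quotient.mk _ d) := fun d =>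
        congrArg g (Quotient.sound
          (Equiv.Perm.sameCycle_apply_left.2 (Equiv.Perm.SameCycle.refl _ _)))
      have hall := hconn.eq_of_invariant (fun d => g (Quotient.mk _ d))
        (hτ _ (fun d => g (Quotient.mk _ d)) hτ' hopp) hopp
      rcases isEmpty_or_nonempty X with hX | ⟨⟨x⟩⟩
      · refine ⟨0, ?_⟩
        ext a
        induction a using Quotient.inductionOn with
        | h a => exact hX.elim a
      · refine ⟨g (Quotient.mk _ x), ?_⟩
        ext a
        induction a using Quotient.inductionOn with
        | h a => simpa using hall x a
  have h2 := LinearMap.finrank_range_add_finrank_ker (incidence D.opp τ).mulVecLin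
  rw [Module.finrank_fintype_fun_eq_card, ← Nat.card_eq_fintype_card] at h2
  change (incidence D.opp τ).rank + _ = _ at h2
  omega

lemma incidence_face_opp_mul (D : LinkDiagram X) :
    (incidence D.face D.opp) * (incidence D.opp D.rot) = 0 := by
  classical
  apply Matrix.ext_of_mulVec_single
  intro v
  rw [← Matrix.mulVec_mulVec, Matrix.zero_mulVec]
  ext r
  rw [incidence_mulVec]
  set g : Quotient (Equiv.Perm.SameCycle.setoid D.rot) → ZMod 2 := Pi.single v 1
  have h2 : ∀ d, g (Quotient.mk _ (D.opp d)) = g (Quotient.mk _ (D.face d)) := by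
    intro d
    rw [← rot_face]
    exact congrArg g (Quotient.sound
      (Equiv.Perm.sameCycle_apply_left.2 (Equiv.Perm.SameCycle.refl _ _)))
  have h3 : ∀ d, (Quotient.mk (Equiv.Perm.SameCycle.setoid D.face) (D.face d)) =
      Quotient.mk _ d := fun d => Quotient.sound
      (Equiv.Perm.sameCycle_apply_left.2 (Equiv.Perm.SameCycle.refl _ _))
  have h4 : (∑ d : X, if (Quotient.mk (Equiv.Perm.SameCycle.setoid D.face) d) = r then
        g (Quotient.mk _ (D.face d)) else 0) =
      ∑ d : X, if (Quotient.mk (Equiv.Perm.SameCycle.setoid D.face) d) = r then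
        g (Quotient.mk _ d) else 0 := by
    rw [← Equiv.sum_comp D.face (fun d => if (Quotient.mk
      (Equiv.Perm.SameCycle.setoid D.face) d) = r then g (Quotient.mk _ d) else 0)]
    simp only [h3]
  simp only [incidence_opp_mulVec, h2]
  simp_rw [← Finset.sum_filter] at h4 ⊢
  rw [Finset.sum_add_distrib, h4, CharTwo.add_self_eq_zero]
  rfl

/-- Vanishing of the first cohomology of the sphere. -/
lemma IsConnected.exists_cut (hconn : D.IsConnected) (f : X → ZMod 2)
    (hf : ∀ d, f (D.opp d) = f d)
    (hclosed : ∀ c, (open Classical in ∑ d : X, if D.SameRegion d c then f d else 0) = 0) :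
    ∃ g : X → ZMod 2, (∀ d, g (D.rot d) = g d) ∧ ∀ d, f d = g d + g (D.opp d) := by
  classical
  set A := incidence D.opp D.rot
  set B := incidence D.face D.opp
  have hle : LinearMap.range A.mulVecLin ≤ LinearMap.ker B.mulVecLin := by
    rw [LinearMap.range_le_ker_iff, ← Matrix.mulVecLin_mul, incidence_face_opp_mul,
      Matrix.mulVecLin_zero]
  have hA := hconn.card_le_rank_incidence D.rot (fun _ _ h _ => h)
  have hB := hconn.card_le_rank_incidence D.face (fun _ g h1 h2 d => by
    have := h1 (D.opp (D.rot d))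
    rw [face_opp_rot, h2] at this
    exact this.symm)
  rw [← incidence_transpose, Matrix.rank_transpose] at hB
  have hker := LinearMap.finrank_range_add_finrank_ker B.mulVecLin
  rw [Module.finrank_fintype_fun_eq_card, ← Nat.card_eq_fintype_card] at hker
  change B.rank + _ = _ at hker
  have hE := D.planar
  rw [show Nat.card _ = 1 from hconn] at hE
  have heq := Submodule.eq_of_le_of_finrank_le hle (by
    change _ ≤ A.rank
    change _ ≤ B.rank + 1 at hB
    change _ ≤ A.rank + 1 at hA
    change _ + Nat.card (Quotient (Equiv.Perm.SameCycle.setoid D.face)) = _ at hE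
    omega)
  let F : Quotient (Equiv.Perm.SameCycle.setoid D.opp) → ZMod 2 :=
    Quotient.lift f (fun a b hab => by
      obtain ⟨i, -, -, rfl⟩ := Equiv.Perm.SameCycle.exists_pow_eq'' hab
      clear hab
      induction i with
      | zero => rfl
      | succ i ih => rw [pow_succ', Equiv.Perm.mul_apply, hf, ← ih])
  have hF : F ∈ LinearMap.ker B.mulVecLin := by
    rw [LinearMap.mem_ker]
    ext r
    induction r using Quotient.inductionOn with
    | h c =>
      rw [Matrix.mulVecLin_apply, incidence_mulVec, Pi.zero_apply]
      refine Eq.trans ?_ (hclosed c)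
      refine Finset.sum_congr rfl fun d _ => ?_
      exact if_congr ⟨fun h => Quotient.exact h, fun h => Quotient.sound h⟩ rfl rfl
  rw [← heq] at hF
  obtain ⟨g, hg⟩ := hF
  refine ⟨fun d => g (Quotient.mk _ d), fun d => congrArg g (Quotient.sound
    (Equiv.Perm.sameCycle_apply_left.2 (Equiv.Perm.SameCycle.refl _ _))), fun d => ?_⟩
  rw [← incidence_opp_mulVec]
  exact (congrFun hg (Quotient.mk _ d)).symm

open Classical in
/-- A closed curve that crosses the edges `h₁, …, h₄`, each from left to right, separates the
crossings into two classes. -/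
lemma IsConnected.exists_cut_of_closed_curve (hconn : D.IsConnected) {h₁ h₂ h₃ h₄ : X}
    (h12 : D.SameRegion (D.opp h₁) h₂) (h23 : D.SameRegion (D.opp h₂) h₃)
    (h34 : D.SameRegion (D.opp h₃) h₄) (h41 : D.SameRegion (D.opp h₄) h₁) :
    ∃ g : X → ZMod 2, (∀ d, g (D.rot d) = g d) ∧ ∀ d, g d + g (D.opp d) =
      ((if d = h₁ then 1 else 0) + (if d = D.opp h₁ then 1 else 0)) +
      ((if d = h₂ then 1 else 0) + (if d = D.opp h₂ then 1 else 0)) +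
      ((if d = h₃ then 1 else 0) + (if d = D.opp h₃ then 1 else 0)) +
      ((if d = h₄ then 1 else 0) + (if d = D.opp h₄ then 1 else 0)) := by
  have hopp : ∀ d e : X, (D.opp d = e) = (d = D.opp e) := fun d e =>
    propext ⟨fun h => by rw [← h, D.opp_opp], fun h => by rw [h, D.opp_opp]⟩
  obtain ⟨g, hg, hfg⟩ := hconn.exists_cut (fun d =>
      ((if d = h₁ then 1 else 0) + (if d = D.opp h₁ then 1 else 0)) +
      ((if d = h₂ then 1 else 0) + (if d = D.opp h₂ then 1 else 0)) +
      ((if d = h₃ then 1 else 0) + (if d = D.opp h₃ then 1 else 0)) +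
      ((if d = h₄ then 1 else 0) + (if d = D.opp h₄ then 1 else 0)))
    (fun d => by simp only [hopp, D.opp_opp]; ring)
    (fun c => by
      have hsum : ∀ h : X, (∑ d : X, if D.SameRegion d c then
          (if d = h then (1 : ZMod 2) else 0) else 0) = if D.SameRegion h c then 1 else 0 := by
        intro h
        rw [Finset.sum_eq_single h]
        · simp
        · intro b _ hb
          simp [hb]
        · simp
      have hiff : ∀ {a b : X}, D.SameRegion a b →
          (D.SameRegion a c) = (D.SameRegion b c) := fun hab =>
        propext ⟨fun h => hab.symm.trans h, fun h => hab.trans h⟩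
      have hite : ∀ (P : Prop) (a b : ZMod 2),
          (if P then a + b else 0) = (if P then a else 0) + (if P then b else 0) := by
        intro P a b
        split_ifs <;> simp
      simp only [hite, Finset.sum_add_distrib, hsum, hiff h12, hiff h23, hiff h34, hiff h41]
      have htwo : (2 : ZMod 2) = 0 := rfl
      linear_combination (((if D.SameRegion h₁ c then 1 else 0) +
        (if D.SameRegion h₂ c then 1 else 0) + (if D.SameRegion h₃ c then 1 else 0) +
        (if D.SameRegion h₄ c then 1 else 0) : ZMod 2)) * htwo)
  exact ⟨g, hg, fun d => (hfg d).symm⟩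

/-- The cut along a closed curve through the corner `c`, the region opposite to this corner, and
another region, from which it comes back through the edge of `y`. Near the crossing of `c` the
curve is pushed off across the edges of `c` and of `D.rot⁻¹ c`. It meets the boundary of the region
of `c` only in `c` and `y`, so it separates the far ends of these edges. -/
lemma IsPrime.exists_cut (hprime : D.IsPrime) (hconn : D.IsConnected)
    (hcr : 1 < D.crossingNumber) (halt : D.IsAlternating) {c y e : X} (hcy : D.SameRegion c y)
    (hne : y ≠ c) (he : D.SameRegion (D.opp y) e)
    (he' : D.SameRegion (D.opp e) (D.rot (D.rot c))) :
    ∃ g : X → ZMod 2, (∀ d, g (D.rot d) = g d) ∧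
      (∀ d, D.isOver d = D.isOver c → d ≠ c → d ≠ y → ¬ D.SameRegion d (D.rot (D.rot c)) →
        g (D.face d) = g d) ∧
      (∀ d, D.isOver d = (!D.isOver c) → ¬ D.SameRegion d (D.opp c) →
        ¬ D.SameRegion d (D.opp y) → g (D.face d) = g d) ∧
      g (D.face c) ≠ g (D.face y) := by
  classical
  have hR := hprime.not_sameRegion_rot_rot hconn hcr
  have h23 : D.SameRegion (D.opp (D.rot⁻¹ c)) (D.rot (D.rot c)) := by
    rw [← rot_inv_rot_inv]
    exact sameRegion_opp _
  obtain ⟨g, hg, hfg⟩ := hconn.exists_cut_of_closed_curve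
    (sameRegion_opp c) (h23.trans he'.symm)
    (by rw [D.opp_opp]; exact he.symm : D.SameRegion (D.opp (D.opp e)) (D.opp y))
    (by rw [D.opp_opp]; exact hcy.symm)
  have hface : ∀ d, g (D.face d) = g (D.opp d) := fun d => by rw [← rot_face, hg]
  simp only [← hface, D.opp_opp] at hfg
  have hoy := hcy.isOver_eq halt
  have hoe : D.isOver e = !D.isOver c := by rw [he.isOver_eq halt, halt, hoy]
  have hoc : D.isOver (D.opp c) = !D.isOver c := halt c
  have hocy : D.isOver (D.opp y) = !D.isOver c := by rw [halt, hoy]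
  have hor : D.isOver (D.rot⁻¹ c) = !D.isOver c := isOver_rot_inv c
  have hoor : D.isOver (D.opp (D.rot⁻¹ c)) = D.isOver c := by rw [halt, hor, Bool.not_not]
  have hoee : D.isOver (D.opp e) = D.isOver c := by rw [halt, hoe, Bool.not_not]
  have hcol : ∀ {d z : X}, D.isOver d = D.isOver c → D.isOver z = (!D.isOver c) → d ≠ z := by
    rintro d z h1 h2 rfl
    rw [h1] at h2
    simp at h2
  have hreg : ∀ {d z w : X}, ¬ D.SameRegion d w → D.SameRegion z w → d ≠ z := by
    rintro d z w h1 h2 rfl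
    exact h1 h2
  have hsame : ∀ d, D.isOver d = D.isOver c → ¬ D.SameRegion d (D.rot (D.rot c)) →
      g d + g (D.face d) = (if d = c then 1 else 0) + (if d = y then 1 else 0) := by
    intro d hd hd'
    rw [hfg, if_neg (hcol hd hoc), if_neg (hcol hd hor), if_neg (hreg hd' h23),
      if_neg (hcol hd hoe), if_neg (hreg hd' he'), if_neg (hcol hd hocy)]
    simp
  refine ⟨g, hg, ?_, ?_, ?_⟩
  · intro d hd h1 h2 h3
    have := hsame d hd h3
    rw [if_neg h1, if_neg h2, add_zero] at this
    exact (CharTwo.add_eq_zero.1 this).symm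
  · intro d hd h1 h2
    have := hfg d
    have h4 : ∀ {z : X}, D.isOver z = D.isOver c → d ≠ z := by
      rintro z hz rfl
      rw [hz] at hd
      simp at hd
    rw [if_neg (h4 rfl), if_neg (hreg h1 (Equiv.Perm.SameCycle.refl _ _)),
      if_neg (hreg h1 (sameRegion_opp c).symm), if_neg (h4 hoor), if_neg (h4 hoee),
      if_neg (hreg h2 he.symm), if_neg (hreg h2 (Equiv.Perm.SameCycle.refl _ _)),
      if_neg (h4 hoy)] at this
    simp only [add_zero] at this
    exact (CharTwo.add_eq_zero.1 this).symm
  · -- Walk from `face c` to `y` along the boundary of the region; the edge of `y` is the only one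
    -- on this way that the curve crosses.
    have hwalk : g y = g (D.face c) := by
      obtain ⟨i, hi⟩ : ∃ i : ℕ, ((D.face ^ i) c) = y := Equiv.Perm.SameCycle.exists_nat_pow_eq hcy
      classical
      have hex : ∃ i : ℕ, ((D.face ^ i) c) = y := ⟨i, hi⟩
      set j := Nat.find hex with hj
      have hjy : (D.face ^ j) c = y := Nat.find_spec hex
      have hjmin : ∀ i < j, (D.face ^ i) c ≠ y := fun i hi => Nat.find_min hex hi
      have key : ∀ i, i < j → g ((D.face ^ (i + 1)) c) = g (D.face c) := by
        intro i
        induction i with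
        | zero => intro _; simp
        | succ i ih =>
          intro hij
          rw [pow_succ', Equiv.Perm.mul_apply, ← ih (by omega)]
          have hcd : D.SameRegion c ((D.face ^ (i + 1)) c) := ⟨((i + 1 : ℕ) : ℤ), by rw [zpow_natCast]⟩
          have hd : D.isOver ((D.face ^ (i + 1)) c) = D.isOver c := hcd.isOver_eq halt
          have h3 := hsame _ hd (fun h => hR c (hcd.trans h))
          rw [if_neg (hjmin _ hij), if_neg, add_zero] at h3
          · exact (CharTwo.add_eq_zero.1 h3).symm
          · -- a return to `c` before `y` would contradict the minimality of `j`
            intro hc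
            apply hjmin (j - (i + 1)) (by omega)
            rw [← hjy]
            conv_rhs => rw [show j = (j - (i + 1)) + (i + 1) by omega, pow_add,
              Equiv.Perm.mul_apply, hc]
      have hj0 : j ≠ 0 := by
        intro h0
        rw [h0] at hjy
        exact hne hjy.symm
      have := key (j - 1) (by omega)
      rwa [show j - 1 + 1 = j by omega, hjy] at this
    have h3 := hsame y hoy (fun h => hR c (hcy.trans h))
    rw [if_neg hne, if_pos rfl, zero_add, hwalk] at h3
    intro heq
    rw [← heq, CharTwo.add_self_eq_zero] at h3
    exact zero_ne_one h3

/-- Two closed curves, one through the opposite corners `c` and `D.rot (D.rot c)` and the edge `y`,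
the other one through the next corner and the next edge of the same region, cross once in this
region. So they have to cross in another region, which has to be the one opposite to both
corners. -/
lemma IsPrime.isBigonRegion_opp_of_corner_side (hprime : D.IsPrime) (hconn : D.IsConnected)
    (hcr : 1 < D.crossingNumber) (halt : D.IsAlternating) {c y e e' : X}
    (hcy : D.SameRegion c y) (hne : y ≠ c) (hne' : D.face y ≠ c)
    (he : D.SameRegion (D.opp y) e) (hec : D.SameRegion (D.opp e) (D.rot (D.rot c)))
    (he' : D.SameRegion (D.opp (D.face y)) e')
    (hec' : D.SameRegion (D.opp e') (D.rot (D.rot (D.face c)))) :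
    D.IsBigonRegion (D.opp c) := by
  have hR := hprime.not_sameRegion_rot_rot hconn hcr
  by_cases hT : D.SameRegion (D.rot (D.rot c)) (D.rot (D.rot (D.face c)))
  · exact hprime.isBigonRegion_opp hconn hcr hT
  exfalso
  obtain ⟨g, hg, hgs, hgo, hgne⟩ := hprime.exists_cut hconn hcr halt hcy hne he hec
  have hcol : ∀ d, D.isOver (D.opp d) = !D.isOver d := halt
  have hface : ∀ d, g (D.face d) = g (D.opp d) := fun d => by rw [← rot_face, hg]
  have hof : D.isOver (D.face y) = D.isOver c := by rw [halt.isOver_face, hcy.isOver_eq halt]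
  have hoe' : D.isOver e' = !D.isOver c := by rw [he'.isOver_eq halt, halt, hof]
  -- no edge of the region opposite to `face c` is crossed
  have hT' : ∀ d, D.SameRegion (D.opp e') d → g (D.face d) = g d := by
    intro d hd
    have hd' := hec'.symm.trans hd
    apply hgs
    · rw [hd.isOver_eq halt, halt, hoe', Bool.not_not]
    · rintro rfl
      exact hR _ ((sameRegion_face d).symm.trans hd'.symm)
    · rintro rfl
      exact hR _ ((sameRegion_face c).symm.trans (hcy.trans hd'.symm))
    · exact fun h => hT (hd'.trans h).symm
  -- nor is one of the region between this region and the edge of `face y`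
  have hS' : ∀ d, D.SameRegion (D.opp (D.face y)) d → g (D.face d) = g d := by
    intro d hd
    apply hgo
    · rw [hd.isOver_eq halt, halt, hof]
    · intro h
      exact hne' (hprime c (D.face y) (hcy.trans (sameRegion_face y)) (hd.trans h).symm)
    · intro h
      exact hprime.face_ne hconn hcr y
        (hprime y (D.face y) (sameRegion_face y) (hd.trans h).symm)
  have h1 : g (D.rot (D.rot (D.face c))) = g (D.opp e') := hec'.eq_of_face g hT'
  rw [hg, hg] at h1
  have h2 : g e' = g (D.opp e') := by
    rw [← hT' _ (Equiv.Perm.SameCycle.refl _ _), face_opp, ← hg (D.rot⁻¹ e'), rot_rot_inv]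
  have h3 : g e' = g (D.opp (D.face y)) := he'.eq_of_face g hS'
  have h4 : g (D.face (D.face y)) = g (D.face y) := hgs _ hof hne'
    (hprime.face_ne hconn hcr y)
    (fun h => hR c ((hcy.trans (sameRegion_face y)).trans h))
  rw [hface] at h4
  exact hgne (by rw [h1, ← h2, h3, h4])

/-- Two closed curves through crossings, from one region to an opposite one: if the second curve
leaves the first region at the two corners that follow those of the first one, then both curves
meet the same opposite region. -/
lemma IsPrime.isBigonRegion_opp_of_corner_corner (hprime : D.IsPrime) (hconn : D.IsConnected)
    (hcr : 1 < D.crossingNumber) (halt : D.IsAlternating) {c y : X}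
    (hcy : D.SameRegion c y) (hne : y ≠ c)
    (h : D.SameRegion (D.rot (D.rot c)) (D.rot (D.rot y)))
    (h' : D.SameRegion (D.rot (D.rot (D.face c))) (D.rot (D.rot (D.face y)))) :
    D.IsBigonRegion (D.opp c) := by
  have hR := hprime.not_sameRegion_rot_rot hconn hcr
  by_cases hT : D.SameRegion (D.rot (D.rot c)) (D.rot (D.rot (D.face c)))
  · exact hprime.isBigonRegion_opp hconn hcr hT
  exfalso
  obtain ⟨g, hg, hgs, -, hgne⟩ := hprime.exists_cut hconn hcr halt hcy hne
    (sameRegion_opp y) (e := D.rot⁻¹ y) (by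
      refine Equiv.Perm.SameCycle.trans (sameRegion_opp _) ?_
      rw [rot_inv_rot_inv]
      exact h.symm)
  have hT' : ∀ d, D.SameRegion (D.rot (D.rot (D.face c))) d → g (D.face d) = g d := by
    intro d hd
    apply hgs
    · rw [hd.isOver_eq halt, isOver_rot_rot, halt.isOver_face]
    · rintro rfl
      exact hR _ ((sameRegion_face d).symm.trans hd.symm)
    · rintro rfl
      exact hR _ ((sameRegion_face c).symm.trans (hcy.trans hd.symm))
    · exact fun h => hT (hd.trans h).symm
  have := h'.eq_of_face g hT'
  rw [hg, hg, hg, hg] at this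
  exact hgne this.symm

/-! ### Strips and the edges they run along -/

/-- The strip that starts at the corner `c` of the 0-handle `s` runs along one of the two edges
that bound this corner, the one on the strand on the side of `s`. This is the half of that edge
based at the crossing of `c`. -/
def heading (D : LinkDiagram X) (s : Bool) (c : X) : X := if D.isOver c = s then c else D.rot c

lemma glue_of_eq {s : Bool} {c : X} (h : D.isOver c = s) : D.glue s c = D.face c := if_pos h

lemma glue_of_ne {s : Bool} {c : X} (h : D.isOver c ≠ s) : D.glue s c = D.face⁻¹ c := if_neg h

lemma heading_of_eq {s : Bool} {c : X} (h : D.isOver c = s) : D.heading s c = c := if_pos h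

lemma heading_of_ne {s : Bool} {c : X} (h : D.isOver c ≠ s) : D.heading s c = D.rot c := if_neg h

lemma isOver_heading (s : Bool) (c : X) : D.isOver (D.heading s c) = s := by
  by_cases h : D.isOver c = s
  · rw [heading_of_eq h, h]
  · rw [heading_of_ne h, D.isOver_rot]
    exact (Bool.eq_not_of_ne (Ne.symm h)).symm

lemma IsAlternating.isOver_face_inv (halt : D.IsAlternating) (c : X) :
    D.isOver (D.face⁻¹ c) = D.isOver c := by
  rw [← halt.isOver_face (D.face⁻¹ c), face_face_inv]

lemma IsAlternating.isOver_glue (halt : D.IsAlternating) (s : Bool) (c : X) :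
    D.isOver (D.glue s c) = D.isOver c := by
  by_cases h : D.isOver c = s
  · rw [glue_of_eq h, halt.isOver_face]
  · rw [glue_of_ne h, halt.isOver_face_inv]

lemma IsAlternating.glue_not_glue (halt : D.IsAlternating) (s : Bool) (c : X) :
    D.glue (!s) (D.glue s c) = c := by
  by_cases h : D.isOver c = s
  · rw [glue_of_ne (by rw [halt.isOver_glue, h]; simp), glue_of_eq h,
      face_inv_face]
  · rw [glue_of_eq (by rw [halt.isOver_glue]; exact Bool.eq_not_of_ne h), glue_of_ne h,
      face_face_inv]

/-- Seen from its other end, a strip runs along the other half of the same edge. -/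
lemma IsAlternating.heading_glue (halt : D.IsAlternating) (s : Bool) (c : X) :
    D.heading (!s) (D.glue s c) = D.opp (D.heading s c) := by
  by_cases h : D.isOver c = s
  · rw [heading_of_ne (by rw [halt.isOver_glue, h]; simp), glue_of_eq h, heading_of_eq h,
      rot_face]
  · rw [heading_of_eq (by rw [halt.isOver_glue]; exact Bool.eq_not_of_ne h), glue_of_ne h,
      heading_of_ne h, face_inv_apply]

/-- There is a closed curve through the two opposite corners `c` and `D.rot (D.rot c)` that crosses
two edges and no other crossing; one of the two edges is `d`, on the boundary of the region of
`c` and not adjacent to this corner. -/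
def ThroughSide (D : LinkDiagram X) (c d : X) : Prop :=
  D.SameRegion c d ∧ d ≠ c ∧ D.face d ≠ c ∧
    ∃ e, D.SameRegion (D.opp d) e ∧ D.SameRegion (D.opp e) (D.rot (D.rot c))

/-- There is a closed curve through the opposite corners at the crossing of `c` and those at the
crossing of `x` that crosses no edge. -/
def ThroughCorner (D : LinkDiagram X) (c x : X) : Prop :=
  D.SameRegion c x ∧ x ≠ c ∧ D.SameRegion (D.rot (D.rot c)) (D.rot (D.rot x))

/-- A strip along the edge from the corner `c` to the corner `face c` runs along a bigon edge if
there is a bigon on the other side of this edge. The two strips at this edge start at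
different ends. -/
lemma isBigonEdge_heading {s : Bool} {c : X}
    (h : D.isOver c = s → D.IsBigonRegion (D.opp c))
    (h' : D.isOver c ≠ s → D.IsBigonRegion (D.opp (D.face⁻¹ c))) :
    D.IsBigonEdge (D.heading s c) := by
  by_cases hs : D.isOver c = s
  · rw [heading_of_eq hs]
    exact Or.inr (h hs)
  · rw [heading_of_ne hs]
    have := h' hs
    rw [face_inv_apply, D.opp_opp] at this
    exact Or.inl this

section Bigon

variable (hprime : D.IsPrime) (hconn : D.IsConnected) (hcr : 1 < D.crossingNumber)
  (halt : D.IsAlternating)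

include hprime hconn hcr

lemma IsPrime.isBigonEdge_of_glue_glue (halt : D.IsAlternating) {s : Bool} {c : X}
    (h : D.glue s (D.glue s c) = c) : D.IsBigonEdge (D.heading s c) := by
  have hc : D.IsBigonRegion c := by
    refine ⟨hprime.face_ne hconn hcr c, ?_⟩
    by_cases hs : D.isOver c = s
    · rwa [glue_of_eq (by rw [halt.isOver_glue, hs]), glue_of_eq hs] at h
    · rw [glue_of_ne (by rwa [halt.isOver_glue]), glue_of_ne hs, Equiv.Perm.inv_eq_iff_eq,
        Equiv.Perm.inv_eq_iff_eq] at h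
      exact h.symm
  by_cases hs : D.isOver c = s
  · rw [heading_of_eq hs]
    exact Or.inl hc
  · rw [heading_of_ne hs]
    refine Or.inr ?_
    rw [← face_inv_apply]
    refine ⟨hprime.face_ne hconn hcr _, ?_⟩
    rw [face_face_inv, Equiv.Perm.eq_inv_iff_eq, hc.2]

lemma IsPrime.isBigonEdge_of_opposite {s : Bool} {c : X}
    (h : D.SameRegion (D.rot (D.rot c)) (D.rot (D.rot (D.glue s c)))) :
    D.IsBigonEdge (D.heading s c) := by
  refine isBigonEdge_heading (fun hs => ?_) (fun hs => ?_)
  · rw [glue_of_eq hs] at h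
    exact hprime.isBigonRegion_opp hconn hcr h
  · rw [glue_of_ne hs] at h
    apply hprime.isBigonRegion_opp hconn hcr
    rw [face_face_inv]
    exact h.symm

include halt

lemma IsPrime.isBigonEdge_of_throughSide {s : Bool} {c d : X}
    (h : D.ThroughSide c d) (h' : D.ThroughSide (D.glue s c) (D.glue s d)) :
    D.IsBigonEdge (D.heading s c) := by
  obtain ⟨hcd, hne, hne', e, he, hec⟩ := h
  obtain ⟨hcd', -, -, e', he', hec'⟩ := h'
  refine isBigonEdge_heading (fun hs => ?_) (fun hs => ?_)
  · rw [glue_of_eq hs] at hec'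
    rw [glue_of_eq (by rwa [hcd.isOver_eq halt])] at he'
    exact hprime.isBigonRegion_opp_of_corner_side hconn hcr halt hcd hne hne' he hec he' hec'
  · rw [glue_of_ne hs] at hec' hcd'
    rw [glue_of_ne (by rwa [hcd.isOver_eq halt])] at he' hcd'
    refine hprime.isBigonRegion_opp_of_corner_side hconn hcr halt hcd' ?_ ?_ he' hec'
      (e' := e) ?_ ?_
    · exact fun h => hne (Equiv.injective _ h)
    · rw [face_face_inv, ne_eq, Equiv.Perm.eq_inv_iff_eq]
      exact hne'
    · rwa [face_face_inv]
    · rwa [face_face_inv]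

lemma IsPrime.isBigonEdge_of_throughCorner {s : Bool} {c x : X}
    (h : D.ThroughCorner c x) (h' : D.ThroughCorner (D.glue s c) (D.glue s x)) :
    D.IsBigonEdge (D.heading s c) := by
  obtain ⟨hcd, hne, h⟩ := h
  obtain ⟨hcd', hne', h'⟩ := h'
  refine isBigonEdge_heading (fun hs => ?_) (fun hs => ?_)
  · rw [glue_of_eq hs, glue_of_eq (by rwa [hcd.isOver_eq halt])] at h'
    exact hprime.isBigonRegion_opp_of_corner_corner hconn hcr halt hcd hne h h'
  · have hs' : D.isOver x ≠ s := by rwa [hcd.isOver_eq halt]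
    rw [glue_of_ne hs, glue_of_ne hs'] at h' hcd' hne'
    apply hprime.isBigonRegion_opp_of_corner_corner hconn hcr halt hcd' hne' h'
    rwa [face_face_inv, face_face_inv]

end Bigon

/-! ### Discs of small area -/

/-- The shapes that are left to a disc whose area is smaller than `π / 4` times the number of its arcs
in `∂M`: its boundary contains the arc in `∂M` from the corner `c` to the corner `c'`, and either two further
edges or one further crossing. The indices are the ends of `∂H - ∂M` next to `c'` and to `c`.
In the last two cases `∂H` surrounds one edge. -/
inductive IsLight (D : LinkDiagram X) (c c' : X) : ArcEnd X → ArcEnd X → Prop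
  | side {d d' : X} : D.ThroughSide c' d → D.ThroughSide c d' → IsLight D c c' (.side d) (.side d')
  | corner {x x' : X} : D.ThroughCorner c' x → D.ThroughCorner c x' →
      IsLight D c c' (.corner x) (.corner x')
  | edge : c' = D.rot c → IsLight D c c' (.corner (D.face c')) (.corner (D.face⁻¹ c))
  | edge' : c = D.rot c' → IsLight D c c' (.corner (D.face⁻¹ c')) (.corner (D.face c))

lemma eq_rot_rot_of_isOver_eq {c c' : X} (h : D.SameCrossing c c') (hne : c ≠ c')
    (hover : D.isOver c' = D.isOver c) : c' = D.rot (D.rot c) := by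
  rcases sameCrossing_cases h with rfl | rfl | rfl | rfl
  · exact absurd rfl hne
  · simp [D.isOver_rot] at hover
  · rfl
  · rw [isOver_rot_inv] at hover
    simp at hover

lemma eq_rot_or_of_isOver_ne {c c' : X} (h : D.SameCrossing c c')
    (hover : D.isOver c' ≠ D.isOver c) : c' = D.rot c ∨ c = D.rot c' := by
  rcases sameCrossing_cases h with rfl | rfl | rfl | rfl
  · exact absurd rfl hover
  · exact Or.inl rfl
  · simp [isOver_rot_rot] at hover
  · exact Or.inr (rot_rot_inv _).symm

/-- A closed curve that passes through two adjacent corners of one crossing and is otherwise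
disjoint from the diagram except for one further edge `d`, crosses the edge between the corners. -/
lemma IsPrime.eq_of_adjacent (hprime : D.IsPrime) {c c' d : X} (h : c' = D.rot c ∨ c = D.rot c')
    (h1 : D.SameRegion c' d) (h2 : D.SameRegion (D.opp d) c) :
    (c' = D.rot c ∧ d = c') ∨ (c = D.rot c' ∧ D.opp d = c) := by
  rcases h with rfl | rfl
  · refine Or.inl ⟨rfl, hprime _ _ h1 ((sameRegion_opp_rot c).trans h2.symm)⟩
  · refine Or.inr ⟨rfl, hprime _ _ h2.symm ?_⟩
    rw [D.opp_opp]
    exact (sameRegion_opp_rot c').trans h1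

section Discs

variable (hprime : D.IsPrime) (hconn : D.IsConnected) (hcr : 1 < D.crossingNumber)
  (halt : D.IsAlternating) {c c' : X}

include hprime hconn hcr halt

lemma IsPrime.not_admissibleArc_corner (h : D.SameCrossing c c') (hne : c ≠ c') :
    ¬ D.AdmissibleArc (.corner c') (.corner c) := by
  rintro ⟨h1, -⟩
  have := eq_rot_rot_of_isOver_eq h hne (h1.isOver_eq halt).symm
  rw [this] at h1
  exact hprime.not_sameRegion_rot_rot hconn hcr c h1.symm

omit hconn hcr in
lemma IsPrime.not_admissibleArc_side (h : D.SameCrossing c c') {d : X}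
    (h1 : D.AdmissibleArc (.corner c') (.side d)) :
    ¬ D.AdmissibleArc (.side (D.opp d)) (.corner c) := by
  intro h2
  obtain ⟨h1, h1', -⟩ := h1
  obtain ⟨h2, h2', -⟩ := h2
  have hov : D.isOver c' ≠ D.isOver c := by
    rw [h2.isOver_eq halt, halt, h1.isOver_eq halt]
    simp
  rcases hprime.eq_of_adjacent (eq_rot_or_of_isOver_ne h hov) h1 h2 with ⟨-, h⟩ | ⟨-, h⟩
  · exact h1' h.symm
  · exact h2' h.symm

omit hprime hconn hcr in
lemma IsAlternating.isLight_side (h : D.SameCrossing c c') (hne : c ≠ c') {d e : X}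
    (h1 : D.AdmissibleArc (.corner c') (.side d))
    (h2 : D.AdmissibleArc (.side (D.opp d)) (.side e))
    (h3 : D.AdmissibleArc (.side (D.opp e)) (.corner c)) :
    D.IsLight c c' (.side d) (.side (D.opp e)) := by
  obtain ⟨h1, hd, hd'⟩ := h1
  obtain ⟨h2, -⟩ := h2
  obtain ⟨h3, he, he'⟩ := h3
  have hov : D.isOver c' = D.isOver c := by
    rw [h3.isOver_eq halt, halt, h2.isOver_eq halt, halt, h1.isOver_eq halt, Bool.not_not]
  have hc' := eq_rot_rot_of_isOver_eq h hne hov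
  have hc : D.rot (D.rot c') = c := by rw [hc', D.rot_four]
  refine .side ⟨h1, hd.symm, hd'.symm, e, h2, hc ▸ h3⟩
    ⟨h3.symm, he.symm, he'.symm, D.opp d, ?_, ?_⟩
  · rw [D.opp_opp]
    exact h2.symm
  · rw [D.opp_opp, ← hc']
    exact h1.symm

omit hconn hcr in
lemma IsPrime.isLight_corner (h : D.SameCrossing c c') (hne : c ≠ c') {x x' : X}
    (hx : D.SameCrossing x x') (hxne : x ≠ x')
    (h1 : D.AdmissibleArc (.corner c') (.corner x))
    (h2 : D.AdmissibleArc (.corner x') (.corner c)) :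
    D.IsLight c c' (.corner x) (.corner x') := by
  obtain ⟨h1, h1'⟩ := h1
  obtain ⟨h2, h2'⟩ := h2
  have hov1 := h1.isOver_eq halt
  have hov2 := h2.isOver_eq halt
  by_cases hov : D.isOver c' = D.isOver c
  · have hc := eq_rot_rot_of_isOver_eq h hne hov
    have hx' := eq_rot_rot_of_isOver_eq hx hxne (by rw [← hov2, hov1, hov])
    refine .corner ⟨h1, h1'.symm, ?_⟩ ⟨h2.symm, h2', ?_⟩
    · rw [hc, D.rot_four, ← hx']
      exact h2.symm
    · rw [hx', D.rot_four, ← hc]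
      exact h1
  · have hx' := eq_rot_or_of_isOver_ne hx (by rw [← hov2, hov1]; exact Ne.symm hov)
    have hc := eq_rot_or_of_isOver_ne h hov
    rcases hx' with rfl | rfl
    · -- the edge between the corners `x` and `rot x` is crossed from the region of `c`
      have := hprime.eq_of_adjacent (d := D.opp (D.rot x)) hc
        (h1.trans (sameRegion_opp_rot x).symm) (by rw [D.opp_opp]; exact h2)
      rcases this with ⟨hc1, hc2⟩ | ⟨-, hc2⟩
      · have e1 : x = D.face c' := by rw [← hc2, face_opp_rot]
        have e2 : D.rot x = D.face⁻¹ c := by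
          rw [face_inv_apply, ← hc1, ← hc2, D.opp_opp]
        rw [e2, e1]
        exact .edge hc1
      · rw [D.opp_opp] at hc2
        exact absurd hc2 h2'
    · have := hprime.eq_of_adjacent (d := D.rot x') hc h1
        ((sameRegion_opp_rot x').trans h2)
      rcases this with ⟨-, hc2⟩ | ⟨hc1, hc2⟩
      · exact absurd hc2.symm h1'
      · have e1 : x' = D.face c := by rw [← hc2, face_opp_rot]
        have e2 : D.rot x' = D.face⁻¹ c' := by
          rw [face_inv_apply, ← hc1, ← hc2, D.opp_opp]
        rw [e2, e1]
        exact .edge' hc1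

end Discs

/-- The contribution of a piece to the canonical combinatorial area, in units of `π / 2`. -/
def _root_.Jump.quarterTurns : Jump X → ℕ
  | .cross _ => 1
  | .boundary _ _ => 2
  | .free _ _ => 6

lemma _root_.Jump.area_canonicalAngles (J : Jump X) :
    J.area D.canonicalAngles = π / 2 * J.quarterTurns := by
  cases J <;> simp only [Jump.area, Jump.quarterTurns, canonicalAngles] <;> push_cast <;> ring

omit [Fintype X] in
lemma _root_.Jump.boundaryCount_lt (J : Jump X) : J.boundaryCount + 1 ≤ J.quarterTurns := by
  cases J <;> simp [Jump.boundaryCount, Jump.quarterTurns]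

lemma AdmissibleDisc.area_canonicalAngles (H : D.AdmissibleDisc) :
    H.area D.canonicalAngles =
      π / 2 * ((∑ j ∈ Finset.range H.m, (H.jump j).quarterTurns : ℕ) : ℝ) - 2 * π := by
  simp only [AdmissibleDisc.area, Jump.area_canonicalAngles]
  push_cast
  rw [Finset.mul_sum]

/-- A disc with an arc in `∂M` either has area at least `π / 4` per such arc, or it is one of the
special discs of `IsLight`. -/
lemma IsPrime.area_or_isLight (hprime : D.IsPrime) (hconn : D.IsConnected)
    (hcr : 1 < D.crossingNumber) (halt : D.IsAlternating) (H : D.AdmissibleDisc) {c c' : X}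
    (h0 : H.jump 0 = .boundary c c') :
    π / 4 ≤ H.area D.canonicalAngles / (H.boundaryCount : ℝ) ∨
      0 ≤ H.area D.canonicalAngles / (H.boundaryCount : ℝ) ∧
        D.IsLight c c' (H.jump 1).source ((H.jump (H.m - 1)).target D) := by
  set T := ∑ j ∈ Finset.range H.m, (H.jump j).quarterTurns with hT
  have harea := H.area_canonicalAngles
  rw [← hT] at harea
  have hpi := Real.pi_pos
  have hb : 1 ≤ H.boundaryCount := by
    have := Finset.single_le_sum (f := fun j => (H.jump j).boundaryCount)
      (fun _ _ => Nat.zero_le _) (Finset.mem_range.2 H.m_pos)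
    simpa [h0, Jump.boundaryCount, AdmissibleDisc.boundaryCount] using this
  have hbR : (1 : ℝ) ≤ H.boundaryCount := by exact_mod_cast hb
  have hTm : H.boundaryCount + H.m ≤ T := by
    have : ∑ j ∈ Finset.range H.m, ((H.jump j).boundaryCount + 1) ≤ T :=
      Finset.sum_le_sum fun j _ => (H.jump j).boundaryCount_lt
    simpa [Finset.sum_add_distrib, AdmissibleDisc.boundaryCount] using this
  have hTb : 2 * H.boundaryCount ≤ T := by
    have : ∑ j ∈ Finset.range H.m, 2 * (H.jump j).boundaryCount ≤ T :=
      Finset.sum_le_sum fun j _ => by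
        cases H.jump j <;> simp [Jump.boundaryCount, Jump.quarterTurns]
    simpa [← Finset.mul_sum, AdmissibleDisc.boundaryCount] using this
  by_cases hbig : 8 + H.boundaryCount ≤ 2 * T
  · left
    rw [le_div_iff₀ (by linarith), harea]
    have : (8 + H.boundaryCount : ℝ) ≤ 2 * T := by exact_mod_cast hbig
    nlinarith
  right
  have harc := H.arc_admissible
  have hadm := H.jump_admissible
  have hper := H.periodic 0
  have hm := H.m_pos
  rw [zero_add, h0] at hper
  obtain ⟨hcc, hne⟩ : D.SameCrossing c c' ∧ c ≠ c' := by simpa [h0, Jump.Admissible] using hadm 0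
  have ha0 := harc 0
  rw [h0] at ha0
  have hnonneg : T = 4 → 0 ≤ H.area D.canonicalAngles / (H.boundaryCount : ℝ) := by
    intro h
    rw [harea, h]
    apply div_nonneg _ (by linarith)
    push_cast
    linarith
  obtain hm | hm | hm : H.m = 1 ∨ H.m = 2 ∨ H.m = 3 := by omega
  · exfalso
    rw [hm] at hper
    rw [zero_add, hper] at ha0
    exact hprime.not_admissibleArc_corner hconn hcr halt hcc hne ha0
  · rw [hm] at hper
    have ha1 := harc 1
    have hj1 := hadm 1
    simp only [AdmissibleDisc.boundaryCount, hm, Finset.sum_range_succ, Finset.sum_range_zero, h0,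
      zero_add] at hT hbig
    simp only [zero_add, Nat.reduceAdd, hper] at ha0 ha1
    rw [hm]
    cases h1 : H.jump 1 with
    | cross d =>
      exfalso
      rw [h1] at ha0 ha1
      exact hprime.not_admissibleArc_side halt hcc ha0 ha1
    | boundary x x' =>
      rw [h1] at ha0 ha1 hj1 hT
      refine ⟨hnonneg (by simpa [Jump.quarterTurns] using hT), ?_⟩
      exact hprime.isLight_corner halt hcc hne hj1.1 hj1.2 ha0 ha1
    | free =>
      rw [h1] at hT hbig
      simp only [Jump.quarterTurns, Jump.boundaryCount] at hT hbig
      omega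
  · rw [hm] at hper
    have ha1 := harc 1
    have ha2 := harc 2
    simp only [AdmissibleDisc.boundaryCount, hm, Finset.sum_range_succ, Finset.sum_range_zero, h0,
      zero_add] at hT hbig
    simp only [zero_add, Nat.reduceAdd, hper] at ha0 ha1 ha2
    rw [hm]
    cases h1 : H.jump 1 <;> cases h2 : H.jump 2 <;> rw [h1, h2] at hT hbig <;>
      simp only [Jump.quarterTurns, Jump.boundaryCount] at hT hbig
    case cross.cross d e =>
      rw [h1] at ha0 ha1
      rw [h2] at ha1 ha2
      refine ⟨hnonneg (by omega), ?_⟩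
      exact halt.isLight_side hcc hne ha0 ha1 ha2
    all_goals omega

/-! ### Consecutive discs of small area -/

/-- The arc in `∂M` from the corner `c` to the corner `c'` goes around an edge from one of its
strips to the other one, and the boundary of the disc surrounds this edge. Here `a` and `a'` are the
ends of `∂H - ∂M` next to `c'` and to `c`. A curve with such an arc runs along the edge and back. -/
def IsTurn (D : LinkDiagram X) (s : Bool) (c c' : X) (a a' : ArcEnd X) : Prop :=
  D.heading s c = D.heading s c' ∧ a = .corner (D.glue s c') ∧ a' = .corner (D.glue s c)

/-- A disc that surrounds an edge either turns around it, or the strips at its arc in `∂M` both lead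
away from this edge. -/
lemma IsLight.cases {c c' : X} {a a' : ArcEnd X} (h : D.IsLight c c' a a')
    (halt : D.IsAlternating) (s : Bool) :
    D.IsTurn s c c' a a' ∨
    (∃ d d', a = .side d ∧ a' = .side d' ∧ D.ThroughSide c' d ∧ D.ThroughSide c d') ∨
    ∃ x x', a = .corner x ∧ a' = .corner x' ∧
      (D.ThroughCorner c' x ∧ D.ThroughCorner c x' ∨ D.glue s x = c' ∧ D.glue s x' = c) := by
  have hne : ∀ {e : X}, D.isOver e = s → D.isOver (D.rot e) ≠ s := by
    rintro e rfl
    simp [D.isOver_rot]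
  have heq : ∀ {e : X}, D.isOver e ≠ s → D.isOver (D.rot e) = s := by
    intro e he
    rw [D.isOver_rot]
    exact (Bool.eq_not_of_ne (Ne.symm he)).symm
  cases h with
  | side h1 h2 => exact Or.inr (Or.inl ⟨_, _, rfl, rfl, h1, h2⟩)
  | corner h1 h2 => exact Or.inr (Or.inr ⟨_, _, rfl, rfl, Or.inl ⟨h1, h2⟩⟩)
  | edge h =>
    subst h
    by_cases hs : D.isOver c = s
    · refine Or.inr (Or.inr ⟨_, _, rfl, rfl, Or.inr ⟨?_, ?_⟩⟩)
      · rw [glue_of_ne (by rw [halt.isOver_face]; exact hne hs), face_inv_face]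
      · rw [glue_of_eq (by rwa [halt.isOver_face_inv]), face_face_inv]
    · refine Or.inl ⟨?_, ?_, ?_⟩
      · rw [heading_of_ne hs, heading_of_eq (heq hs)]
      · rw [glue_of_eq (heq hs)]
      · rw [glue_of_ne hs]
  | edge' h =>
    subst h
    by_cases hs : D.isOver c' = s
    · refine Or.inr (Or.inr ⟨_, _, rfl, rfl, Or.inr ⟨?_, ?_⟩⟩)
      · rw [glue_of_eq (by rwa [halt.isOver_face_inv]), face_face_inv]
      · rw [glue_of_ne (by rw [halt.isOver_face]; exact hne hs), face_inv_face]
    · refine Or.inl ⟨?_, ?_, ?_⟩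
      · rw [heading_of_ne hs, heading_of_eq (heq hs)]
      · rw [glue_of_ne hs]
      · rw [glue_of_eq (heq hs)]

section Pairs

variable (hprime : D.IsPrime) (hconn : D.IsConnected) (hcr : 1 < D.crossingNumber)
  (halt : D.IsAlternating) {s : Bool} {c c' b : X} {a₁ a₂ a₃ a₄ : ArcEnd X}

include hprime hconn hcr halt

/-- Between two consecutive discs of small area the curve runs along a bigon edge, unless it turns
around at one of the two. Here `a₂` and `a₃` are the matching ends of the two discs. -/
lemma IsPrime.isBigonEdge_of_isLight (hmatch : D.MatchEnds s a₂ a₃)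
    (h : D.IsLight c c' a₂ a₁) (h' : D.IsLight (D.glue s c') b a₄ a₃)
    (ht : ¬ D.IsTurn s c c' a₂ a₁) (ht' : ¬ D.IsTurn (!s) (D.glue s c') b a₄ a₃) :
    D.IsBigonEdge (D.heading s c') := by
  rcases (h.cases halt s).resolve_left ht with ⟨d, d₁, rfl, rfl, h1, -⟩ | ⟨x, x₁, rfl, rfl, h1⟩ <;>
  rcases (h'.cases halt (!s)).resolve_left ht' with
    ⟨d₄, d', rfl, rfl, -, h2⟩ | ⟨x₄, x', rfl, rfl, h2⟩
  · obtain rfl : d' = D.glue s d := hmatch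
    exact hprime.isBigonEdge_of_throughSide hconn hcr halt h1 h2
  · exact hmatch.elim
  · exact hmatch.elim
  · obtain rfl : x' = D.glue s x := hmatch
    have h2 : D.ThroughCorner (D.glue s c') (D.glue s x) ∨ x = D.glue s c' := by
      rcases h2 with ⟨-, h2⟩ | ⟨-, h2⟩
      · exact Or.inl h2
      · rw [halt.glue_not_glue] at h2
        exact Or.inr h2
    rcases h1 with ⟨h1, -⟩ | ⟨h1, -⟩ <;> rcases h2 with h2 | h2
    · exact hprime.isBigonEdge_of_throughCorner hconn hcr halt h1 h2
    · rw [h2] at h1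
      exact hprime.isBigonEdge_of_opposite hconn hcr h1.2.2
    · rw [h1] at h2
      exact hprime.isBigonEdge_of_opposite hconn hcr h2.2.2.symm
    · rw [h2] at h1
      exact hprime.isBigonEdge_of_glue_glue hconn hcr halt h1

lemma IsPrime.isBigonEdge_of_isTurn (hmatch : D.MatchEnds s a₂ a₃)
    (h : D.IsTurn s c c' a₂ a₁) (h' : D.IsTurn (!s) (D.glue s c') b a₄ a₃) :
    D.IsBigonEdge (D.heading s c') := by
  obtain ⟨-, rfl, -⟩ := h
  obtain ⟨-, -, rfl⟩ := h'
  rw [halt.glue_not_glue] at hmatch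
  exact hprime.isBigonEdge_of_glue_glue hconn hcr halt (Eq.symm hmatch)

end Pairs

/-! ### Homology: how often a curve runs along an edge -/

lemma heading_rot_inv_of_eq {s : Bool} {c : X} (h : D.isOver c = s) :
    D.heading s (D.rot⁻¹ c) = D.heading s c := by
  rw [heading_of_eq h, heading_of_ne (by rw [isOver_rot_inv, h]; simp), rot_rot_inv]

lemma heading_rot_inv_of_ne {s : Bool} {c : X} (h : D.isOver c ≠ s) :
    D.heading s (D.rot⁻¹ c) = D.rot (D.rot (D.heading s c)) := by
  rw [heading_of_ne h, heading_of_eq, rot_inv_eq]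
  rw [isOver_rot_inv]
  exact (Bool.eq_not_of_ne (Ne.symm h)).symm

lemma heading_rot_of_ne {s : Bool} {c : X} (h : D.isOver c ≠ s) :
    D.heading s (D.rot c) = D.heading s c := by
  simpa using (heading_rot_inv_of_eq (D := D) (s := s) (c := D.rot c) (by
    rw [D.isOver_rot]
    exact (Bool.eq_not_of_ne (Ne.symm h)).symm)).symm

open Classical in
/-- The number of times a 1-chain runs along the edge of `d` in the direction of `d`, where `d`
starts at an over-crossing. -/
noncomputable def edgeCount (D : LinkDiagram X) (d : X) : (X →₀ ℤ) →+ ℤ :=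
  Finsupp.liftAddHom fun c => if D.heading true c = d then AddMonoidHom.id ℤ else 0

open Classical in
lemma edgeCount_single (d c : X) (n : ℤ) :
    D.edgeCount d (Finsupp.single c n) = if D.heading true c = d then n else 0 := by
  rw [edgeCount, Finsupp.liftAddHom_apply_single]
  split_ifs <;> rfl

lemma IsAlternating.edgeCount_twoHandleBoundary (halt : D.IsAlternating) (d c : X) :
    D.edgeCount d (D.twoHandleBoundary c) = 0 := by
  have hg : ∀ c, D.heading true (D.glue false c) = D.opp (D.heading false c) :=
    fun c => halt.heading_glue false c
  have hg' : ∀ c, D.heading false (D.glue true c) = D.opp (D.heading true c) :=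
    fun c => halt.heading_glue true c
  simp only [twoHandleBoundary, map_add, map_sub, edgeCount_single]
  cases hc : D.isOver c
  · have e2 : D.heading true (D.glue false (D.rot⁻¹ (D.glue true c))) = D.heading true c := by
      rw [hg, heading_rot_inv_of_eq (by rw [halt.isOver_glue, hc]), hg', D.opp_opp]
    have o3 : D.isOver (D.rot (D.glue false (D.rot⁻¹ (D.glue true c)))) = false := by
      rw [D.isOver_rot, halt.isOver_glue, isOver_rot_inv, halt.isOver_glue, hc, Bool.not_not]
    have e4 : D.heading true (D.glue false (D.rot⁻¹ (D.glue true
        (D.rot (D.glue false (D.rot⁻¹ (D.glue true c))))))) =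
        D.heading true (D.rot (D.glue false (D.rot⁻¹ (D.glue true c)))) := by
      rw [hg, heading_rot_inv_of_eq (by rw [halt.isOver_glue, o3]), hg', D.opp_opp]
    rw [e2, e4]
    ring
  · have o2 : D.isOver (D.glue false (D.rot⁻¹ (D.glue true c))) = false := by
      rw [halt.isOver_glue, isOver_rot_inv, halt.isOver_glue, hc, Bool.not_true]
    have e3 := heading_rot_of_ne (D := D) (s := true)
      (c := D.glue false (D.rot⁻¹ (D.glue true c))) (by rw [o2]; exact Bool.false_ne_true)
    have o3 : D.isOver (D.rot (D.glue false (D.rot⁻¹ (D.glue true c)))) = true := by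
      rw [D.isOver_rot, o2, Bool.not_false]
    have e4 : D.heading true (D.glue false (D.rot⁻¹ (D.glue true
        (D.rot (D.glue false (D.rot⁻¹ (D.glue true c))))))) = D.heading true c := by
      rw [hg, heading_rot_inv_of_ne (by rw [halt.isOver_glue, o3]; simp), hg', e3, hg,
        D.opp_opp, heading_rot_inv_of_ne (by rw [halt.isOver_glue, hc]; simp), D.rot_four, hg',
        D.opp_opp]
    rw [e3, e4]
    ring

lemma IsAlternating.heading_leftStrip (halt : D.IsAlternating) (d : X) :
    D.heading true (D.leftStrip d) = if D.isOver d then d else D.opp d := by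
  cases hd : D.isOver d
  · have h : D.isOver (D.opp d) = true := by rw [halt, hd, Bool.not_false]
    simp only [leftStrip, hd, Bool.false_eq_true, if_false]
    rw [heading_rot_inv_of_eq h, heading_of_eq h]
  · simp only [leftStrip, hd, if_true]
    exact heading_of_eq hd

lemma IsAlternating.edgeCount_meridian (halt : D.IsAlternating) (d e : X) :
    D.edgeCount d (D.meridian e) = 0 := by
  have : D.heading true (D.leftStrip (D.opp e)) = D.heading true (D.leftStrip e) := by
    rw [halt.heading_leftStrip, halt.heading_leftStrip, halt, D.opp_opp]
    cases D.isOver e <;> rfl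
  rw [meridian, map_sub, edgeCount_single, edgeCount_single, this, sub_self]

open Classical in
lemma IsAlternating.edgeCount_blackboardLongitude (halt : D.IsAlternating) (k : X) {d : X}
    (hd : D.isOver d = true) :
    D.edgeCount d (D.blackboardLongitude k) =
      (if D.OnComponent k d then 1 else 0) - (if D.OnComponent k (D.opp d) then 1 else 0) := by
  have hd' : D.isOver (D.opp d) = false := by rw [halt, hd, Bool.not_true]
  have h : ∀ e, D.edgeCount d (Finsupp.single (D.leftStrip e) (if D.isOver e then 1 else -1)) =
      (if e = d then 1 else 0) - (if e = D.opp d then 1 else 0) := by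
    intro e
    rw [edgeCount_single, halt.heading_leftStrip]
    cases he : D.isOver e
    · have h1 : e ≠ d := by
        rintro rfl
        simp [hd] at he
      have h2 : D.opp e = d ↔ e = D.opp d :=
        ⟨fun h => by rw [← h, D.opp_opp], fun h => by rw [h, D.opp_opp]⟩
      simp only [Bool.false_eq_true, if_false, h1, h2]
      split_ifs <;> simp
    · have h1 : e ≠ D.opp d := by
        rintro rfl
        simp [hd'] at he
      simp [h1]
  simp only [blackboardLongitude, map_sum, h, Finset.sum_sub_distrib, Finset.sum_ite_eq',
    Finset.mem_filter, Finset.mem_univ, true_and]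

lemma travel_opp_travel (d : X) : D.travel (D.opp (D.travel d)) = D.opp d := by
  simp [travel, D.opp_opp, D.rot_four]

/-- A component of a link runs through each of its edges in only one direction. -/
lemma OnComponent.not_opp {k d : X} (h : D.OnComponent k d) : ¬ D.OnComponent k (D.opp d) := by
  intro h'
  obtain ⟨n, hn⟩ := Equiv.Perm.SameCycle.exists_nat_pow_eq (Equiv.Perm.SameCycle.trans h.symm h')
  -- walking backwards from the reversed edge reverses the walk
  have key : ∀ j : ℕ, (D.travel ^ j) (D.opp ((D.travel ^ j) d)) = D.opp d := by
    intro j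
    induction j with
    | zero => simp
    | succ j ih =>
      rw [pow_succ, Equiv.Perm.mul_apply, ← pow_succ, pow_succ', Equiv.Perm.mul_apply,
        travel_opp_travel, ih]
  obtain ⟨j, rfl | rfl⟩ := Nat.even_or_odd' n
  · rw [← key j, two_mul, pow_add, Equiv.Perm.mul_apply] at hn
    exact D.opp_ne _ (Equiv.injective _ hn).symm
  · rw [← key j, two_mul, add_assoc, pow_add, Equiv.Perm.mul_apply] at hn
    have := Equiv.injective _ hn
    rw [pow_succ', Equiv.Perm.mul_apply] at this
    exact D.rot_two_ne _ this

/-- The half-edge along which the strip `C¹ᵢ` of a curve runs. -/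
def BoundaryCurve.step (C : D.BoundaryCurve) (i : ℕ) : X := D.heading (C.sheet i) (C.last i)

lemma BoundaryCurve.heading_first_succ (halt : D.IsAlternating) (C : D.BoundaryCurve) (i : ℕ) :
    D.heading (C.sheet (i + 1)) (C.first (i + 1)) = D.opp (C.step i) := by
  rw [C.sheet_succ, C.first_succ, halt.heading_glue, step]

open Classical in
/-- The signed number of times the strip `C¹ᵢ` runs along `d`. -/
noncomputable def BoundaryCurve.stepCount (C : D.BoundaryCurve) (d : X) (i : ℕ) : ℤ :=
  (if C.step i = d then 1 else 0) - (if C.step i = D.opp d then 1 else 0)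

lemma BoundaryCurve.edgeCount_cycle (halt : D.IsAlternating) (C : D.BoundaryCurve) {d : X}
    (hd : D.isOver d = true) :
    D.edgeCount d C.cycle = ∑ i ∈ Finset.range C.n, C.stepCount d i := by
  classical
  have hd' : D.isOver (D.opp d) = false := by rw [halt, hd, Bool.not_true]
  rw [cycle, map_sum]
  refine Finset.sum_congr rfl fun i _ => ?_
  have ho : D.isOver (C.step i) = C.sheet i := isOver_heading _ _
  cases hs : C.sheet i
  · have h1 : C.step i ≠ d := by
      intro h
      rw [h, hd, hs] at ho
      simp at ho
    have h2 := C.heading_first_succ halt i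
    rw [C.sheet_succ, hs, Bool.not_false] at h2
    have h3 : D.opp (C.step i) = d ↔ C.step i = D.opp d :=
      ⟨fun h => by rw [← h, D.opp_opp], fun h => by rw [h, D.opp_opp]⟩
    simp only [Bool.false_eq_true, if_false, map_neg, edgeCount_single, h2, stepCount, h1, h3,
      zero_sub]
  · have h1 : C.step i ≠ D.opp d := by
      intro h
      rw [h, hd', hs] at ho
      simp at ho
    have h2 : D.heading true (C.last i) = C.step i := by rw [step, hs]
    simp only [if_true, edgeCount_single, h2, stepCount, h1, if_false, sub_zero]

lemma BoundaryCurve.stepCount_opp (C : D.BoundaryCurve) (d : X) (i : ℕ) :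
    C.stepCount (D.opp d) i = - C.stepCount d i := by
  rw [stepCount, stepCount, D.opp_opp]
  ring

/-- A curve representing `m` times the slope `p / q` runs algebraically `m * q` times along each edge
of the component. -/
lemma BoundaryCurve.abs_sum_stepCount (halt : D.IsAlternating) (C : D.BoundaryCurve) {k : X}
    {p q m : ℤ} (h : D.Homologous C.cycle (m • D.slope k p q)) {d : X}
    (hd : D.OnComponent k d) :
    |∑ i ∈ Finset.range C.n, C.stepCount d i| = |m * q| := by
  have hker : ∀ e, D.edgeCount e C.cycle =
      m * (q * D.edgeCount e (D.blackboardLongitude k)) := by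
    intro e
    have hle : AddSubgroup.closure (Set.range D.twoHandleBoundary) ≤ (D.edgeCount e).ker := by
      rw [AddSubgroup.closure_le]
      rintro _ ⟨c, rfl⟩
      exact halt.edgeCount_twoHandleBoundary e c
    have := hle h
    rw [AddMonoidHom.mem_ker, map_sub, sub_eq_zero] at this
    rw [this, slope, longitude]
    simp [halt.edgeCount_meridian]
  cases ho : D.isOver d
  · have ho' : D.isOver (D.opp d) = true := by rw [halt, ho, Bool.not_false]
    have h1 := C.edgeCount_cycle halt ho'
    rw [hker, halt.edgeCount_blackboardLongitude k ho', D.opp_opp, if_neg hd.not_opp,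
      if_pos hd] at h1
    simp only [stepCount_opp, Finset.sum_neg_distrib] at h1
    rw [← abs_neg, ← h1, ← abs_neg]
    congr 1
    ring
  · have h1 := C.edgeCount_cycle halt ho
    rw [hker, halt.edgeCount_blackboardLongitude k ho, if_neg hd.not_opp, if_pos hd] at h1
    rw [← h1]
    congr 1
    ring

/-! ### The lower bound -/

lemma sum_range_succ_of_periodic {M : Type*} [AddCommGroup M] {n : ℕ} (F : ℕ → M)
    (hF : ∀ i, F (i + n) = F i) :
    ∑ i ∈ Finset.range n, F (i + 1) = ∑ i ∈ Finset.range n, F i := by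
  have h1 := Finset.sum_range_succ F n
  rw [Finset.sum_range_succ'] at h1
  have h2 := hF 0
  rw [zero_add] at h2
  rw [h2] at h1
  exact add_right_cancel h1

/-- The curve turns around at its `i`-th disc. -/
def InwardExtension.TurnsAt {C : D.BoundaryCurve} (E : D.InwardExtension C) (i : ℕ) : Prop :=
  D.IsTurn (C.sheet i) (C.first i) (C.last i) ((E.disc i).jump 1).source
    (((E.disc i).jump ((E.disc i).m - 1)).target D)

section Weight

variable (hprime : D.IsPrime) (hconn : D.IsConnected) (hcr : 1 < D.crossingNumber)
  (halt : D.IsAlternating) {C : D.BoundaryCurve} (E : D.InwardExtension C)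

include hprime hconn hcr halt

lemma InwardExtension.isBigonEdge_of_turnsAt {i : ℕ} (h : E.TurnsAt i) (h' : E.TurnsAt (i + 1)) :
    D.IsBigonEdge (C.step i) := by
  rw [TurnsAt, C.sheet_succ, C.first_succ] at h'
  exact hprime.isBigonEdge_of_isTurn hconn hcr halt (E.agree i) h h'

/-- A strip along an edge that is not a bigon edge has an end on a disc of large weight, unless the
curve turns around at one of its ends. -/
lemma InwardExtension.large_or_large {i : ℕ} (hb : ¬ D.IsBigonEdge (C.step i))
    (h : ¬ E.TurnsAt i) (h' : ¬ E.TurnsAt (i + 1)) :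
    π / 4 ≤ (E.disc i).area D.canonicalAngles / ((E.disc i).boundaryCount : ℝ) ∨
    π / 4 ≤ (E.disc (i + 1)).area D.canonicalAngles / ((E.disc (i + 1)).boundaryCount : ℝ) := by
  by_contra! hlt
  have h1 := (hprime.area_or_isLight hconn hcr halt (E.disc i) (E.contains i)).resolve_left
    (not_le.2 hlt.1)
  have h2 := (hprime.area_or_isLight hconn hcr halt (E.disc (i + 1))
    (E.contains (i + 1))).resolve_left (not_le.2 hlt.2)
  rw [TurnsAt, C.sheet_succ, C.first_succ] at h'
  rw [C.first_succ] at h2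
  exact hb (hprime.isBigonEdge_of_isLight hconn hcr halt (E.agree i) h1.2 h2.2 h h')

open Classical in
/-- Strips next to a turn cancel in pairs, so the remaining ones account for the algebraic number
of times the curve runs along an edge. -/
lemma InwardExtension.abs_sum_stepCount_le {d : X} (hd : ¬ D.IsBigonEdge d) :
    |∑ i ∈ Finset.range C.n, C.stepCount d i| ≤
      ((Finset.range C.n).filter fun i => (C.step i = d ∨ C.step i = D.opp d) ∧
        ¬ E.TurnsAt i ∧ ¬ E.TurnsAt (i + 1)).card := by
  have hd' : ¬ D.IsBigonEdge (D.opp d) := by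
    rw [IsBigonEdge, D.opp_opp, or_comm]
    exact hd
  set t : ℕ → ℤ := fun i => if E.TurnsAt i then 1 else 0 with ht
  have hzero : ∀ i, C.step i ≠ d → C.step i ≠ D.opp d → C.stepCount d i = 0 := by
    intro i h1 h2
    rw [BoundaryCurve.stepCount, if_neg h1, if_neg h2, sub_zero]
  have hsplit : ∀ i, C.stepCount d i =
      (if ¬ E.TurnsAt i ∧ ¬ E.TurnsAt (i + 1) then C.stepCount d i else 0) +
      (C.stepCount d i * t i + C.stepCount d i * t (i + 1)) := by
    intro i
    by_cases h1 : E.TurnsAt i <;> by_cases h2 : E.TurnsAt (i + 1) <;> simp only [ht, h1, h2] <;>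
      simp
    have hbig := E.isBigonEdge_of_turnsAt hprime hconn hcr halt h1 h2
    exact hzero i (fun h => hd (h ▸ hbig)) (fun h => hd' (h ▸ hbig))
  have hcancel : ∀ i, C.stepCount d (i + 1) * t (i + 1) + C.stepCount d i * t (i + 1) = 0 := by
    intro i
    by_cases h : E.TurnsAt (i + 1)
    · have h1 := C.heading_first_succ halt i
      rw [h.1] at h1
      change C.step (i + 1) = _ at h1
      have h2 : ∀ e, D.opp (C.step i) = e ↔ C.step i = D.opp e := fun e =>
        ⟨fun h => by rw [← h, D.opp_opp], fun h => by rw [h, D.opp_opp]⟩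
      simp only [BoundaryCurve.stepCount, h1, h2, D.opp_opp]
      ring
    · simp [ht, h]
  have hper : ∀ i, C.stepCount d (i + C.n) * t (i + C.n) = C.stepCount d i * t i := by
    intro i
    have h1 : C.step (i + C.n) = C.step i := by
      rw [BoundaryCurve.step, C.sheet_periodic, C.last_periodic, ← BoundaryCurve.step]
    have h2 : E.TurnsAt (i + C.n) ↔ E.TurnsAt i := by
      simp only [InwardExtension.TurnsAt, C.sheet_periodic, C.last_periodic, C.first_periodic,
        E.periodic]
    have h3 : t (i + C.n) = t i := if_congr h2 rfl rfl
    rw [h3, BoundaryCurve.stepCount, h1, ← BoundaryCurve.stepCount]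
  have hsum :
      ∑ i ∈ Finset.range C.n, (C.stepCount d i * t i + C.stepCount d i * t (i + 1)) = 0 := by
    rw [Finset.sum_add_distrib,
      ← sum_range_succ_of_periodic (fun i => C.stepCount d i * t i) hper,
      ← Finset.sum_add_distrib]
    exact Finset.sum_eq_zero fun i _ => hcancel i
  rw [Finset.sum_congr rfl fun i _ => hsplit i, Finset.sum_add_distrib, hsum, add_zero,
    Finset.card_filter]
  push_cast
  refine (Finset.abs_sum_le_sum_abs _ _).trans (Finset.sum_le_sum fun i _ => ?_)
  by_cases hturn : ¬ E.TurnsAt i ∧ ¬ E.TurnsAt (i + 1)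
  · rw [if_pos hturn]
    by_cases hi : C.step i = d ∨ C.step i = D.opp d
    · rw [if_pos ⟨hi, hturn⟩, BoundaryCurve.stepCount]
      split_ifs <;> simp
    · rw [if_neg (fun h => hi h.1), hzero i (fun h => hi (Or.inl h)) (fun h => hi (Or.inr h)),
        abs_zero]
  · rw [if_neg hturn, if_neg (fun h => hturn h.2), abs_zero]

lemma InwardExtension.le_weight {k : X} {p q m : ℤ} (hm : m ≠ 0)
    (h : D.Homologous C.cycle (m • D.slope k p q)) :
    |(q : ℝ)| * D.twistNumber k * (π / 4) ≤ E.weight D.canonicalAngles := by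
  classical
  set w : ℕ → ℝ := fun i =>
    (E.disc i).area D.canonicalAngles / ((E.disc i).boundaryCount : ℝ) with hw
  set N := Finset.univ.filter fun d => D.OnComponent k d ∧ ¬ D.IsBigonEdge d with hN
  have hNmem : ∀ {d}, d ∈ N → D.OnComponent k d ∧ ¬ D.IsBigonEdge d := fun hd =>
    (Finset.mem_filter.1 hd).2
  set S : X → Finset ℕ := fun d => (Finset.range C.n).filter fun i =>
    (C.step i = d ∨ C.step i = D.opp d) ∧ ¬ E.TurnsAt i ∧ ¬ E.TurnsAt (i + 1) with hS
  have hdisj : (N : Set X).PairwiseDisjoint S := by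
    intro d hd e he hne
    have hd1 := (hNmem hd).1
    have he1 := (hNmem he).1
    refine Finset.disjoint_left.2 fun i hi hi' => ?_
    obtain h1 | h1 := (Finset.mem_filter.1 hi).2.1 <;>
      obtain h2 | h2 := (Finset.mem_filter.1 hi').2.1
    · exact hne (h1.symm.trans h2)
    · rw [← h1, h2] at hd1
      exact he1.not_opp hd1
    · rw [← h2, h1] at he1
      exact hd1.not_opp he1
    · exact hne (D.opp.injective (h1.symm.trans h2))
  have hcount : (N.card : ℤ) * |m * q| ≤ ((N.biUnion S).card : ℤ) := by
    rw [Finset.card_biUnion (fun d hd e he hne => hdisj hd he hne), ← nsmul_eq_mul,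
      ← Finset.sum_const]
    push_cast
    refine Finset.sum_le_sum fun d hd => ?_
    rw [← C.abs_sum_stepCount halt h (hNmem hd).1]
    exact E.abs_sum_stepCount_le hprime hconn hcr halt (hNmem hd).2
  have hnonneg : ∀ i, 0 ≤ w i := fun i => by
    rcases hprime.area_or_isLight hconn hcr halt (E.disc i) (E.contains i) with h | h
    · exact le_trans (by positivity) h
    · exact h.1
  -- each remaining strip has one of its two ends on a disc of large weight
  have hweight : ((N.biUnion S).card : ℝ) * (π / 4) ≤
      ∑ i ∈ Finset.range C.n, (w i + w (i + 1)) := by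
    rw [← nsmul_eq_mul, ← Finset.sum_const]
    have hsub : N.biUnion S ⊆ Finset.range C.n := fun i hi => by
      obtain ⟨d, -, hi⟩ := Finset.mem_biUnion.1 hi
      exact (Finset.mem_filter.1 hi).1
    refine le_trans (Finset.sum_le_sum fun i hi => ?_)
      (Finset.sum_le_sum_of_subset_of_nonneg hsub
        fun i _ _ => add_nonneg (hnonneg i) (hnonneg (i + 1)))
    obtain ⟨d, hd, hi⟩ := Finset.mem_biUnion.1 hi
    obtain ⟨-, hstep, ht, ht'⟩ := Finset.mem_filter.1 hi
    have hb : ¬ D.IsBigonEdge (C.step i) := by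
      rcases hstep with h1 | h1 <;> rw [h1]
      · exact (hNmem hd).2
      · rw [IsBigonEdge, D.opp_opp, or_comm]
        exact (hNmem hd).2
    rcases E.large_or_large hprime hconn hcr halt hb ht ht' with h1 | h1
    · exact le_add_of_le_of_nonneg h1 (hnonneg _)
    · exact le_add_of_nonneg_of_le (hnonneg _) h1
  rw [Finset.sum_add_distrib, sum_range_succ_of_periodic w
    (fun i => by simp only [hw, E.periodic])] at hweight
  have hm1 : |q| ≤ |m * q| := by
    rw [abs_mul]
    exact le_mul_of_one_le_left (abs_nonneg _) (Int.one_le_abs hm)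
  have hcount' : (N.card : ℝ) * |(q : ℝ)| ≤ (N.biUnion S).card := by
    have : (N.card : ℤ) * |q| ≤ ((N.biUnion S).card : ℤ) :=
      (mul_le_mul_of_nonneg_left hm1 (Int.natCast_nonneg _)).trans hcount
    exact_mod_cast this
  have hpi : 0 ≤ π / 4 := by positivity
  have hfin := (mul_le_mul_of_nonneg_right hcount' hpi).trans hweight
  have htw : D.twistNumber k = (N.card : ℝ) / 2 := by
    rw [twistNumber, hN]
  change _ ≤ ∑ i ∈ Finset.range C.n, w i
  rw [htw]
  linarith

end Weight

end LinkDiagram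

theorem theorem5p4 {X : Type*} [Fintype X] (D : LinkDiagram X)
    (hconnected : D.IsConnected) (hprime : D.IsPrime) (halternating : D.IsAlternating)
    (hcrossings : 1 < D.crossingNumber) (k : X) (p q : ℤ) (hpq : IsCoprime p q) :
    ((|(q : ℝ)| * D.twistNumber k * (π / 4) : ℝ) : EReal) ≤
      LinkDiagram.combinatorialLength D.canonicalAngles (D.slope k p q) := by
  refine le_iInf fun C => le_iInf fun E => EReal.coe_le_coe_iff.2 ?_
  obtain ⟨m, hm, hC⟩ := C.2
  exact E.le_weight hprime hconnected hcrossings halternating hm hC
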